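/- For $\gamma>0$ and $\beta\ge 0$ consider the pendulum system $$\dot\phi=z,\qquad \dot z=\beta-\sin\phi-\gamma z. \tag{1}$$ For $0\le\beta\le1$ put $A_0=(-\pi-\arcsin\beta,0)$ and $A_1=(\pi-\arcsin\beta,0)$; these are consecutive equilibria (saddles if $\beta<1$). Let $R(\beta)$ denote the trajectory of (1) that departs from $A_0$ into the upper half plane, i.e. that tends to $A_0$ as $t\to-\infty$ and has $z>0$ for all sufficiently negative $t$. Call $\beta\in[0,1]$ *critical* for $\gamma$ if $R(\beta)$ tends to $A_1$ as $t\to+\infty$. A *periodic solution* $z=z(\phi)$ is a nowhere vanishing function on $\mathbb R$ with $z(\phi+2\pi)=z(\phi)$ and $\dfrac{dz}{d\phi}=\dfrac{\beta-\sin\phi}{z}-\gamma$. A *cycle on the cylinder* is a non-constant solution $(\phi(t),z(t))$ of (1) for which there are $T>0$ and $n\in\mathbb Z$ with $\phi(t+T)=\phi(t)+2\pi n$ and $z(t+T)=z(t)$ for all $t$; the integer $n$ is its winding number. **Theorem.** Let $\gamma_1>0$. (a) There is a critical value $\beta_0=\beta_0(\gamma_1)$ for $\gamma_1$ with $0<\beta_0\le1$;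 the trajectory $R(\beta_0)$ lies entirely in $\{z>0\}$ and runs from $A_0$ into $A_1$. (b) $\beta_0(\gamma_1)$ is the only critical value in $[0,1]$ for $\gamma_1$. (c) For $\gamma=\gamma_1$ and every $\beta>\beta_0(\gamma_1)$ there is a periodic solution $z_T(\phi)$ with $z_T(\phi)>0$ for all $\phi\in\mathbb R$, and its graph is traversed by a cycle on the cylinder with winding number $1$. For $0\le\beta<\beta_0(\gamma_1)$ there is no periodic solution $z(\phi)$, and no cycle on the cylinder of any winding number. (d) For $\gamma=\gamma_1$ and $\beta\ge0$, if a periodic solution $z_T(\phi)$ exists, then it is the only one, every cycle on the cylinder lies on its graph, and it is an orbitally stable limit cycle: for every $\varepsilon>0$ there is $\delta>0$ such that each solution of (1) starting at distance less than $\delta$ from the graph of $z_T$ stays at distance less than $\varepsilon$ from it for all $t\ge0$; and there is $\delta>0$ such that for each solution starting at distance less than $\delta$ from the graph, this distance tends to $0$ as $t\to+\infty$. (e) If $\beta_0(\gamma_1)=1$, then $\beta_0(\gamma_2)=1$ for every $\gamma_2>\gamma_1$. -/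

import Mathlib

open Filter Topology

/-- `(φ, z)` is a solution, on the whole time axis, of the damped driven pendulum system
`φ' = z`, `z' = β - sin φ - γ z`.  (The vector field is globally Lipschitz, so every solution
extends to the whole time axis.) -/
structure IsPendulumSolution (γ β : ℝ) (φ z : ℝ → ℝ) : Prop where
  deriv_phi : ∀ t, HasDerivAt φ (z t) t
  deriv_z : ∀ t, HasDerivAt z (β - Real.sin (φ t) - γ * z t) t

/-- The singular point `A₀ = (-π - arcsin β, 0)` (used for `0 ≤ β ≤ 1`). -/
noncomputable def saddleA0 (β : ℝ) : ℝ × ℝ := (-Real.pi - Real.arcsin β, 0)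

/-- The next singular point `A₁ = (π - arcsin β, 0)` (used for `0 ≤ β ≤ 1`). -/
noncomputable def saddleA1 (β : ℝ) : ℝ × ℝ := (Real.pi - Real.arcsin β, 0)

/-- `(φ, z)` parametrizes the trajectory `R(β)` departing from `A₀` into the upper half plane:
it is a solution that emanates from `A₀` (as `t → -∞`) and has `z > 0` near `A₀`. -/
structure IsDepartingTrajectory (γ β : ℝ) (φ z : ℝ → ℝ) : Prop where
  sol : IsPendulumSolution γ β φ z
  tendsto_A0 : Tendsto (fun t => (φ t, z t)) atBot (𝓝 (saddleA0 β))
  upper : ∀ᶠ t in atBot, 0 < z t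

/-- `β` is a critical drive for the friction `γ`: the singular points exist, and a trajectory
departing from `A₀` into the upper half plane runs into `A₁`. -/
def IsCriticalDrive (γ β : ℝ) : Prop :=
  0 ≤ β ∧ β ≤ 1 ∧ ∃ φ z : ℝ → ℝ, IsDepartingTrajectory γ β φ z ∧
    Tendsto (fun t => (φ t, z t)) atTop (𝓝 (saddleA1 β))

/-- `z = z(φ)` is a `2π`-periodic solution of the orbit equation
`dz/dφ = (β - sin φ) / z - γ` on the whole line. A trajectory that is a graph over the whole
`φ`-axis never meets `z = 0`. -/
structure IsPeriodicGraph (γ β : ℝ) (z : ℝ → ℝ) : Prop where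
  ne_zero : ∀ φ, z φ ≠ 0
  deriv : ∀ φ, HasDerivAt z ((β - Real.sin φ) / z φ - γ) φ
  periodic : Function.Periodic z (2 * Real.pi)

/-- `(φ, z)` is a non-constant solution that is periodic on the cylinder (`φ` modulo `2π`) and
winds `n` times around it in one period. Here `n = 0` is an ordinary closed orbit (a cycle of the
first kind), and `n ≠ 0` is a rotational cycle (of the second kind). -/
structure IsCylinderCycle (γ β : ℝ) (n : ℤ) (φ z : ℝ → ℝ) : Prop where
  sol : IsPendulumSolution γ β φ z
  nonconstant : ¬ ∃ a b : ℝ, ∀ t, φ t = a ∧ z t = b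
  periodic : ∃ T : ℝ, 0 < T ∧
    ∀ t, φ (t + T) = φ t + 2 * Real.pi * (n : ℝ) ∧ z (t + T) = z t

/-- The graph of `z`; for a `2π`-periodic `z` it is the full lift to the plane of a closed curve
on the cylinder, so planar distance to it is distance to that curve on the cylinder. -/
def graphCurve (z : ℝ → ℝ) : Set (ℝ × ℝ) := {p | p.2 = z p.1}

/-- Asymptotic orbital stability of the closed curve `graphCurve zT` on the cylinder: solutions
that start close to the curve stay close to it, and they converge to it as `t → ∞`. -/
structure IsStableLimitCycle (γ β : ℝ) (zT : ℝ → ℝ) : Prop where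
  stable : ∀ ε > 0, ∃ δ > 0, ∀ φ z : ℝ → ℝ, IsPendulumSolution γ β φ z →
    Metric.infDist (φ 0, z 0) (graphCurve zT) < δ →
    ∀ t, 0 ≤ t → Metric.infDist (φ t, z t) (graphCurve zT) < ε
  attracting : ∃ δ > 0, ∀ φ z : ℝ → ℝ, IsPendulumSolution γ β φ z →
    Metric.infDist (φ 0, z 0) (graphCurve zT) < δ →
    Tendsto (fun t => Metric.infDist (φ t, z t) (graphCurve zT)) atTop (𝓝 0)

/-! ### Ordinary differential equations and periodic functions -/

/-! Write an orbit in the upper half plane as a graph `y(x)` and use `q = y²/2`. The orbit equation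
becomes `q' = β - sin x - γ y`, which makes sense even where `y = 0` and whose right side decreases
in `y`. Hence at a minimum of the difference of two half-squares the derivatives agree and the
graphs can be compared there. This single argument orders periodic graphs, makes them unique
(`IsNonnegGraph.eq`), and puts every periodic subsolution below the solution.

Existence is a fixed point of the period map (`exists_graph_of_sub`), so the drives with a positive
periodic graph form an up-set. It is open at its lower end, because a strictly positive graph can be
lowered a little. Its infimum is the critical drive `β₀`, which is not attained. As `β ↓ β₀` the
graphs decrease with a Lipschitz constant independent of `β`, and the limit is a periodic graph that
must touch zero (`exists_critical_graph`). By energy dissipation it can do so only at the saddles,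
so the flow along it joins `A₀` to `A₁`.

Everything else compares a trajectory with a graph through the relative energy `e = y(φ)²/2 - z²/2`.
For unequal drives the minimum argument applies to `e`. For equal drives `e²` is nonincreasing while
`z > 0`. This excludes other critical drives, excludes cycles below `β₀`, places every cycle on the
graph, and near a positive graph gives exponential decay, hence stability. -/

theorem exists_global_solution {f : ℝ → ℝ → ℝ} {K M : NNReal}
    (hf : ∀ t, LipschitzWith K (f t)) (hc : ∀ x, Continuous fun t => f t x)
    (hM : ∀ t x, |f t x| ≤ M) (x₀ : ℝ) :
    ∃ x : ℝ → ℝ, x 0 = x₀ ∧ ∀ t, HasDerivAt x (f t (x t)) t := by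
  have key : ∀ n : ℕ, ∃ x : ℝ → ℝ, x 0 = x₀ ∧
      ∀ t ∈ Set.Ioo (-((n : ℝ) + 1)) (n + 1), HasDerivAt x (f t (x t)) t := by
    intro n
    have hn : (0 : ℝ) ≤ n := n.cast_nonneg
    have h0 : (0 : ℝ) ∈ Set.Icc (-((n : ℝ) + 1)) (n + 1) := ⟨by linarith, by linarith⟩
    have hp : IsPicardLindelof f (⟨0, h0⟩ : Set.Icc (-((n : ℝ) + 1)) (n + 1)) x₀
        (M * (n + 1)) 0 M K := by
      refine ⟨fun t _ => (hf t).lipschitzOnWith, fun x _ => (hc x).continuousOn,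
        fun t _ x _ => hM t x, ?_⟩
      simp
    obtain ⟨x, hx, hx'⟩ := hp.exists_eq_forall_mem_Icc_hasDerivWithinAt₀
    exact ⟨x, hx, fun t ht => (hx' t (Set.Ioo_subset_Icc_self ht)).hasDerivAt
      (Icc_mem_nhds ht.1 ht.2)⟩
  choose x hx hx' using key
  have agree : ∀ (m n : ℕ), m ≤ n → ∀ t ∈ Set.Ioo (-((m : ℝ) + 1)) (m + 1), x m t = x n t := by
    intro m n hmn
    have hmn' : (m : ℝ) ≤ n := by exact_mod_cast hmn
    have hm : (0 : ℝ) ≤ m := m.cast_nonneg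
    exact ODE_solution_unique_of_mem_Ioo (v := f) (s := fun _ => Set.univ) (t₀ := 0)
      (fun t _ => (hf t).lipschitzOnWith) ⟨by linarith, by linarith⟩
      (fun t ht => ⟨hx' m t ht, trivial⟩)
      (fun t ht => ⟨hx' n t ⟨by linarith [ht.1], by linarith [ht.2]⟩, trivial⟩)
      (by rw [hx, hx])
  -- The index `n = ⌈|t|⌉₊` suffices because the `n`-th local solution lives on `(-(n+1), n+1)`,
  -- which contains a whole neighbourhood of `t`.
  refine ⟨fun t => x ⌈|t|⌉₊ t, hx _, fun t => ?_⟩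
  set n := ⌈|t|⌉₊ with hn
  have htn : |t| < (n : ℝ) + 1 := by linarith [Nat.le_ceil |t|]
  have hmem : t ∈ Set.Ioo (-((n : ℝ) + 1)) (n + 1) := abs_lt.1 htn
  refine (hx' n t hmem).congr_of_eventuallyEq ?_
  filter_upwards [Ioo_mem_nhds hmem.1 hmem.2] with s hs
  have hs1 : s ∈ Set.Ioo (-((⌈|s|⌉₊ : ℝ) + 1)) (⌈|s|⌉₊ + 1) :=
    abs_lt.1 (by linarith [Nat.le_ceil |s|])
  rcases le_total ⌈|s|⌉₊ n with h | h
  · exact agree _ _ h s hs1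
  · exact (agree _ _ h s hs).symm

theorem solution_unique {f : ℝ → ℝ → ℝ} {K : NNReal} (hf : ∀ t, LipschitzWith K (f t))
    {x y : ℝ → ℝ} (hx : ∀ t, HasDerivAt x (f t (x t)) t) (hy : ∀ t, HasDerivAt y (f t (y t)) t)
    {t₀ : ℝ} (h : x t₀ = y t₀) : x = y :=
  ODE_solution_unique_univ (v := f) (s := fun _ => Set.univ)
    (fun t => (hf t).lipschitzOnWith) (fun t => ⟨hx t, trivial⟩) (fun t => ⟨hy t, trivial⟩) h

theorem Function.Periodic.exists_isMin {f : ℝ → ℝ} {T : ℝ} (hT : 0 < T)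
    (hp : Function.Periodic f T) (hc : Continuous f) : ∃ x, ∀ y, f x ≤ f y := by
  obtain ⟨x, -, hx⟩ := (isCompact_Icc (a := (0 : ℝ)) (b := T)).exists_isMinOn
    ⟨0, le_rfl, hT.le⟩ hc.continuousOn
  refine ⟨x, fun y => ?_⟩
  obtain ⟨w, hw, hwy⟩ := hp.exists_mem_Ico₀ hT y
  rw [hwy]
  exact hx (Set.Ico_subset_Icc_self hw)

theorem Function.Periodic.exists_isMax {f : ℝ → ℝ} {T : ℝ} (hT : 0 < T)
    (hp : Function.Periodic f T) (hc : Continuous f) : ∃ x, ∀ y, f y ≤ f x := by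
  obtain ⟨x, hx⟩ := Function.Periodic.exists_isMin hT (f := fun t => -f t)
    (fun t => by simp only [hp t]) hc.neg
  exact ⟨x, fun y => neg_le_neg_iff.1 (hx y)⟩

theorem deriv_eq_zero_of_forall_le {f : ℝ → ℝ} {f' x : ℝ} (h : ∀ y, f x ≤ f y)
    (hf : HasDerivAt f f' x) : f' = 0 :=
  IsLocalMin.hasDerivAt_eq_zero (Filter.Eventually.of_forall h) hf

theorem deriv_eq_zero_of_forall_ge {f : ℝ → ℝ} {f' x : ℝ} (h : ∀ y, f y ≤ f x)
    (hf : HasDerivAt f f' x) : f' = 0 :=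
  IsLocalMax.hasDerivAt_eq_zero (Filter.Eventually.of_forall h) hf

/-- A continuous function which lies somewhere below its limits at both ends has a minimum. -/
theorem exists_isMin_of_tendsto {f : ℝ → ℝ} (hc : Continuous f) {L₁ L₂ t₀ : ℝ}
    (h₁ : Tendsto f atBot (𝓝 L₁)) (h₂ : Tendsto f atTop (𝓝 L₂)) (hL₁ : f t₀ < L₁)
    (hL₂ : f t₀ < L₂) : ∃ t, ∀ s, f t ≤ f s := by
  refine hc.exists_forall_le' t₀ ?_
  rw [cocompact_eq_atBot_atTop]
  exact eventually_sup.2 ⟨(h₁.eventually_const_lt hL₁).mono fun _ h => h.le,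
    (h₂.eventually_const_lt hL₂).mono fun _ h => h.le⟩

theorem antitoneOn_of_hasDerivAt_nonpos {f f' : ℝ → ℝ} {s : Set ℝ} (hs : Convex ℝ s)
    (hf : ∀ t, HasDerivAt f (f' t) t) (h : ∀ t ∈ interior s, f' t ≤ 0) : AntitoneOn f s :=
  antitoneOn_of_deriv_nonpos hs (fun t _ => (hf t).continuousAt.continuousWithinAt)
    (fun t _ => (hf t).differentiableAt.differentiableWithinAt) fun t ht => by
      rw [(hf t).deriv]; exact h t ht

/-- If an antitone differentiable function has an equal limit at both ends, its derivative
vanishes. -/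
theorem deriv_eq_zero_of_antitone_of_tendsto {f f' : ℝ → ℝ} (hf : ∀ t, HasDerivAt f (f' t) t)
    (ha : Antitone f) {L : ℝ} (h₁ : Tendsto f atBot (𝓝 L)) (h₂ : Tendsto f atTop (𝓝 L)) (t : ℝ) :
    f t = L ∧ f' t = 0 := by
  have hconst : ∀ s, f s = L := fun s => le_antisymm (ha.ge_of_tendsto h₁ s)
    (ha.le_of_tendsto h₂ s)
  refine ⟨hconst t, ?_⟩
  have : f = fun _ => L := funext hconst
  exact (hf t).unique (this ▸ hasDerivAt_const t L)

/-! ### Solutions of the pendulum system -/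

namespace IsPendulumSolution

variable {γ β : ℝ} {φ z φ' z' : ℝ → ℝ}

theorem continuous_phi (h : IsPendulumSolution γ β φ z) : Continuous φ :=
  continuous_iff_continuousAt.2 fun t => (h.deriv_phi t).continuousAt

theorem continuous_z (h : IsPendulumSolution γ β φ z) : Continuous z :=
  continuous_iff_continuousAt.2 fun t => (h.deriv_z t).continuousAt

theorem shift (h : IsPendulumSolution γ β φ z) (c : ℝ) :
    IsPendulumSolution γ β (fun t => φ (t + c)) (fun t => z (t + c)) :=
  ⟨fun t => (h.deriv_phi (t + c)).comp_add_const t c,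
    fun t => (h.deriv_z (t + c)).comp_add_const t c⟩

theorem unique (h : IsPendulumSolution γ β φ z) (h' : IsPendulumSolution γ β φ' z') {t₀ : ℝ}
    (hφ : φ t₀ = φ' t₀) (hz : z t₀ = z' t₀) : φ = φ' ∧ z = z' := by
  have hsin : LipschitzWith 1 Real.sin := Real.lipschitzWith_sin
  have hL : LipschitzWith (max 1 (1 + Real.nnabs γ * 1))
      (fun p : ℝ × ℝ => (p.2, β - Real.sin p.1 - γ * p.2)) := by
    refine LipschitzWith.prodMk LipschitzWith.prod_snd ?_
    refine LipschitzWith.of_dist_le_mul fun p q => ?_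
    have h1 : |Real.sin p.1 - Real.sin q.1| ≤ |p.1 - q.1| := by
      simpa [Real.dist_eq] using hsin.dist_le_mul p.1 q.1
    have h2 : |p.1 - q.1| ≤ dist p q := by
      rw [Prod.dist_eq, ← Real.dist_eq]; exact le_max_left _ _
    have h3 : |p.2 - q.2| ≤ dist p q := by
      rw [Prod.dist_eq, ← Real.dist_eq]; exact le_max_right _ _
    have h4 : |γ * (p.2 - q.2)| ≤ |γ| * dist p q := by
      rw [abs_mul]; exact mul_le_mul_of_nonneg_left h3 (abs_nonneg _)
    rw [Real.dist_eq]
    have h5 : β - Real.sin p.1 - γ * p.2 - (β - Real.sin q.1 - γ * q.2)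
        = -(Real.sin p.1 - Real.sin q.1) - γ * (p.2 - q.2) := by ring
    rw [h5]
    calc _ ≤ |-(Real.sin p.1 - Real.sin q.1)| + |γ * (p.2 - q.2)| := abs_sub _ _
      _ ≤ dist p q + |γ| * dist p q := by rw [abs_neg]; linarith
      _ = _ := by simp; ring
  have := ODE_solution_unique_univ (v := fun _ p => (p.2, β - Real.sin p.1 - γ * p.2))
    (s := fun _ => Set.univ) (f := fun t => (φ t, z t)) (g := fun t => (φ' t, z' t)) (t₀ := t₀)
    (fun t => hL.lipschitzOnWith) (fun t => ⟨(h.deriv_phi t).prodMk (h.deriv_z t), trivial⟩)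
    (fun t => ⟨(h'.deriv_phi t).prodMk (h'.deriv_z t), trivial⟩) (by simp [hφ, hz])
  exact ⟨funext fun t => congrArg Prod.fst (congrFun this t),
    funext fun t => congrArg Prod.snd (congrFun this t)⟩

theorem eq_const (h : IsPendulumSolution γ β φ z) {t₀ : ℝ} (hz : z t₀ = 0)
    (hφ : β - Real.sin (φ t₀) = 0) (t : ℝ) : φ t = φ t₀ ∧ z t = 0 := by
  have hc : IsPendulumSolution γ β (fun _ => φ t₀) (fun _ => 0) :=
    ⟨fun t => hasDerivAt_const _ _, fun t => by simpa [hφ] using hasDerivAt_const t (0 : ℝ)⟩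
  obtain ⟨h1, h2⟩ := h.unique hc (t₀ := t₀) rfl hz
  exact ⟨congrFun h1 t, congrFun h2 t⟩

end IsPendulumSolution

/-- The potential of the driven pendulum. -/
noncomputable def pendulumPotential (β x : ℝ) : ℝ := -Real.cos x - β * x

theorem hasDerivAt_pendulumPotential (β x : ℝ) :
    HasDerivAt (pendulumPotential β) (Real.sin x - β) x := by
  have := ((Real.hasDerivAt_cos x).neg).sub ((hasDerivAt_id x).const_mul β)
  exact (this.congr_deriv (by simp)).congr_of_eventuallyEq (Eventually.of_forall fun _ => rfl)

theorem continuous_pendulumPotential (β : ℝ) : Continuous (pendulumPotential β) :=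
  continuous_iff_continuousAt.2 fun x => (hasDerivAt_pendulumPotential β x).continuousAt

theorem pendulumPotential_add (β x : ℝ) (n : ℤ) :
    pendulumPotential β (x + 2 * Real.pi * n) = pendulumPotential β x - 2 * Real.pi * β * n := by
  have : Real.cos (x + 2 * Real.pi * n) = Real.cos x := by
    rw [mul_comm]; exact Real.cos_add_int_mul_two_pi x n
  simp only [pendulumPotential, this]
  ring

/-- Beyond a singular point where the potential has a maximum, the potential stays below its
value there. -/
theorem pendulumPotential_le {β s x : ℝ} (hβ : 0 ≤ β) (hs : Real.sin s = β)
    (hc : Real.cos s ≤ 0) (hx : s ≤ x) : pendulumPotential β x ≤ pendulumPotential β s := by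
  obtain ⟨d, hd, rfl⟩ : ∃ d, 0 ≤ d ∧ x = s + d := ⟨x - s, by linarith, by ring⟩
  simp only [pendulumPotential, Real.cos_add, hs]
  -- The increment of the potential is `cos s (1 - cos d) + β (sin d - d)`, and both terms are
  -- nonpositive.
  have h1 := mul_nonneg hβ (sub_nonneg.2 (Real.sin_le hd))
  have h2 := mul_nonneg (neg_nonneg.2 hc) (sub_nonneg.2 (Real.cos_le_one d))
  nlinarith

/-! ### Energy dissipation and turning points -/

namespace IsPendulumSolution

variable {γ β : ℝ} {φ z : ℝ → ℝ}

theorem hasDerivAt_energy (h : IsPendulumSolution γ β φ z) (t : ℝ) :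
    HasDerivAt (fun t => z t ^ 2 / 2 + pendulumPotential β (φ t)) (-(γ * z t ^ 2)) t := by
  have h1 := (((h.deriv_z t).pow 2).div_const 2).add
    ((hasDerivAt_pendulumPotential β (φ t)).comp t (h.deriv_phi t))
  refine h1.congr_deriv ?_
  simp
  ring

theorem antitone_energy (hγ : 0 < γ) (h : IsPendulumSolution γ β φ z) :
    Antitone (fun t => z t ^ 2 / 2 + pendulumPotential β (φ t)) :=
  antitone_of_hasDerivAt_nonpos h.hasDerivAt_energy fun t => by
    have := mul_nonneg hγ.le (sq_nonneg (z t))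
    simpa using this

/-- A solution which does not lose energy is at rest. -/
theorem eq_const_of_energy_le (hγ : 0 < γ) (h : IsPendulumSolution γ β φ z) {t₁ t₂ : ℝ}
    (ht : t₁ < t₂) (hE : z t₁ ^ 2 / 2 + pendulumPotential β (φ t₁) ≤
      z t₂ ^ 2 / 2 + pendulumPotential β (φ t₂)) :
    ∃ a, β - Real.sin a = 0 ∧ ∀ t, φ t = a ∧ z t = 0 := by
  have hanti := h.antitone_energy hγ
  have hz : ∀ t ∈ Set.Ioo t₁ t₂, z t = 0 := by
    intro t ht
    have hev : (fun t => z t ^ 2 / 2 + pendulumPotential β (φ t)) =ᶠ[𝓝 t]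
        fun _ => z t₁ ^ 2 / 2 + pendulumPotential β (φ t₁) := by
      filter_upwards [Ioo_mem_nhds ht.1 ht.2] with s hs
      exact le_antisymm (hanti hs.1.le) (hE.trans (hanti hs.2.le))
    have h0 := (h.hasDerivAt_energy t).unique
      ((hasDerivAt_const t _).congr_of_eventuallyEq hev)
    have : γ * z t ^ 2 = 0 := by linarith
    simpa [hγ.ne'] using this
  set m := (t₁ + t₂) / 2 with hm
  have hmem : m ∈ Set.Ioo t₁ t₂ := ⟨by rw [hm]; linarith, by rw [hm]; linarith⟩
  have hev : z =ᶠ[𝓝 m] fun _ => 0 := by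
    filter_upwards [Ioo_mem_nhds hmem.1 hmem.2] with s hs using hz s hs
  have h0 := (h.deriv_z m).unique ((hasDerivAt_const m _).congr_of_eventuallyEq hev)
  have h1 : β - Real.sin (φ m) = 0 := by rw [hz m hmem] at h0; linarith
  exact ⟨φ m, h1, h.eq_const (hz m hmem) h1⟩

theorem eq_const_of_return (hγ : 0 < γ) (h : IsPendulumSolution γ β φ z) {t₁ t₂ : ℝ}
    (ht : t₁ < t₂) (hz : z t₁ = 0) (hφ : φ t₂ = φ t₁) :
    ∃ a, β - Real.sin a = 0 ∧ ∀ t, φ t = a ∧ z t = 0 :=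
  h.eq_const_of_energy_le hγ ht (by rw [hz, hφ]; nlinarith [sq_nonneg (z t₂)])

/-- Between a time with `z > 0` and a later time with `z < 0` there is a turning point. -/
theorem exists_turning (h : IsPendulumSolution γ β φ z) {t₀ t₁ : ℝ}
    (h01 : t₀ < t₁) (hz₀ : 0 < z t₀) (hz₁ : z t₁ < 0) :
    ∃ m ∈ Set.Ioo t₀ t₁, z m = 0 ∧ ∀ t ∈ Set.Icc t₀ t₁, φ t ≤ φ m := by
  obtain ⟨m, hm, hmax⟩ := (isCompact_Icc (a := t₀) (b := t₁)).exists_isMaxOn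
    ⟨t₀, le_rfl, h01.le⟩ h.continuous_phi.continuousOn
  -- The maximum of `φ` is interior: `φ` still increases at `t₀` and already decreases on reaching
  -- `t₁`.
  have hslope := fun t => hasDerivAt_iff_tendsto_slope_left_right.1 (h.deriv_phi t)
  have hm0 : m ≠ t₀ := by
    rintro rfl
    have hev : ∀ᶠ s in 𝓝[>] m, φ m < φ s := by
      filter_upwards [(hslope m).2.eventually_const_lt hz₀, self_mem_nhdsWithin] with s hs hsm
      rw [slope_def_field, div_pos_iff] at hs
      have hsm' : m < s := hsm
      rcases hs with hs | hs <;> linarith [hs.1, hs.2]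
    obtain ⟨s, hs1, hs2⟩ := (hev.and (Ioo_mem_nhdsGT h01)).exists
    exact absurd (hmax (Set.Ioo_subset_Icc_self hs2)) (not_le.2 hs1)
  have hm1 : m ≠ t₁ := by
    rintro rfl
    have hev : ∀ᶠ s in 𝓝[<] m, φ m < φ s := by
      filter_upwards [(hslope m).1.eventually_lt_const hz₁, self_mem_nhdsWithin] with s hs hsm
      rw [slope_def_field, div_neg_iff] at hs
      have hsm' : s < m := hsm
      rcases hs with hs | hs <;> linarith [hs.1, hs.2]
    obtain ⟨s, hs1, hs2⟩ := (hev.and (Ioo_mem_nhdsLT h01)).exists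
    exact absurd (hmax (Set.Ioo_subset_Icc_self hs2)) (not_le.2 hs1)
  have hm' : m ∈ Set.Ioo t₀ t₁ := ⟨lt_of_le_of_ne hm.1 hm0.symm, lt_of_le_of_ne hm.2 hm1⟩
  exact ⟨m, hm', (hmax.isLocalMax (Icc_mem_nhds hm'.1 hm'.2)).hasDerivAt_eq_zero (h.deriv_phi m),
    fun t ht => hmax ht⟩

/-- A solution with `z = 0` somewhere and not at rest has `z < 0` somewhere nearby. -/
theorem exists_neg (h : IsPendulumSolution γ β φ z)
    (hne : ¬ ∃ a, β - Real.sin a = 0 ∧ ∀ t, φ t = a ∧ z t = 0) {t₀ : ℝ} (hz : z t₀ ≤ 0) :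
    ∃ t, z t < 0 := by
  by_contra! hcon
  have hz0 : z t₀ = 0 := le_antisymm hz (hcon t₀)
  have := deriv_eq_zero_of_forall_le (fun s => hz0.symm ▸ hcon s) (h.deriv_z t₀)
  have h1 : β - Real.sin (φ t₀) = 0 := by rw [hz0] at this; linarith
  exact hne ⟨φ t₀, h1, h.eq_const hz0 h1⟩

end IsPendulumSolution

/-! ### Cycles on the cylinder and critical trajectories -/

theorem sin_saddle {β : ℝ} (h₀ : 0 ≤ β) (h₁ : β ≤ 1) :
    Real.sin (Real.pi - Real.arcsin β) = β := by
  rw [Real.sin_pi_sub, Real.sin_arcsin (by linarith) h₁]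

theorem cos_saddle_nonpos (β : ℝ) : Real.cos (Real.pi - Real.arcsin β) ≤ 0 := by
  rw [Real.cos_pi_sub]
  linarith [Real.cos_arcsin_nonneg β]

theorem IsDepartingTrajectory.tendsto_phi {γ β : ℝ} {φ z : ℝ → ℝ}
    (h : IsDepartingTrajectory γ β φ z) :
    Tendsto φ atBot (𝓝 (-Real.pi - Real.arcsin β)) :=
  (continuous_fst.tendsto _).comp h.tendsto_A0

theorem IsDepartingTrajectory.tendsto_z {γ β : ℝ} {φ z : ℝ → ℝ}
    (h : IsDepartingTrajectory γ β φ z) : Tendsto z atBot (𝓝 0) :=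
  (continuous_snd.tendsto _).comp h.tendsto_A0

theorem IsDepartingTrajectory.not_at_rest {γ β : ℝ} {φ z : ℝ → ℝ}
    (h : IsDepartingTrajectory γ β φ z) :
    ¬ ∃ a, β - Real.sin a = 0 ∧ ∀ t, φ t = a ∧ z t = 0 := by
  rintro ⟨a, -, ha⟩
  obtain ⟨t, ht⟩ := h.upper.exists
  exact ht.ne' (ha t).2

/-- A departing trajectory that runs into `A₁` stays above the axis. -/
theorem IsDepartingTrajectory.pos_of_tendsto {γ β : ℝ} (hγ : 0 < γ) (h₀ : 0 ≤ β) (h₁ : β ≤ 1)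
    {φ z : ℝ → ℝ} (h : IsDepartingTrajectory γ β φ z)
    (hlim : Tendsto (fun t => (φ t, z t)) atTop (𝓝 (saddleA1 β))) (t : ℝ) : 0 < z t := by
  by_contra! hneg
  obtain ⟨t₁, ht₁⟩ := h.sol.exists_neg h.not_at_rest hneg
  obtain ⟨t₀, ht₀, h01⟩ := (h.upper.and (eventually_lt_atBot t₁)).exists
  obtain ⟨m, hm, hzm, hmax⟩ := h.sol.exists_turning h01 ht₀ ht₁
  set s := Real.pi - Real.arcsin β with hs
  have hφ : Tendsto φ atTop (𝓝 s) := (continuous_fst.tendsto _).comp hlim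
  have hz : Tendsto z atTop (𝓝 0) := (continuous_snd.tendsto _).comp hlim
  refine h.not_at_rest ?_
  -- A turning point short of `A₁` would have to be passed again later, with no less energy than at
  -- rest there. One at or beyond `A₁` has energy at most that of `A₁`, which is the limit of the
  -- energy. In both cases no energy is lost, so the solution is at rest.
  rcases lt_or_ge (φ m) s with hms | hms
  · obtain ⟨r, hr, hr1⟩ := ((hφ.eventually_const_lt hms).and (eventually_gt_atTop t₁)).exists
    obtain ⟨q, hq, hqm⟩ := intermediate_value_Icc hr1.le h.sol.continuous_phi.continuousOn
      (show φ m ∈ Set.Icc (φ t₁) (φ r) from ⟨hmax _ ⟨h01.le, le_rfl⟩, hr.le⟩)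
    exact h.sol.eq_const_of_return hγ (hm.2.trans_le hq.1) hzm hqm
  · refine h.sol.eq_const_of_energy_le hγ hm.2 ?_
    have hE : Tendsto (fun t => z t ^ 2 / 2 + pendulumPotential β (φ t)) atTop
        (𝓝 (0 ^ 2 / 2 + pendulumPotential β s)) :=
      ((hz.pow 2).div_const 2).add (((continuous_pendulumPotential β).tendsto s).comp hφ)
    have h2 := (h.sol.antitone_energy hγ).le_of_tendsto hE t₁
    have h3 := pendulumPotential_le h₀ (sin_saddle h₀ h₁) (cos_saddle_nonpos β) hms
    simp only [hzm] at h2 ⊢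
    linarith

namespace IsCylinderCycle

variable {γ β : ℝ} {n : ℤ} {φ z : ℝ → ℝ}

theorem not_at_rest (h : IsCylinderCycle γ β n φ z) :
    ¬ ∃ a, β - Real.sin a = 0 ∧ ∀ t, φ t = a ∧ z t = 0 :=
  fun ⟨a, _, ha⟩ => h.nonconstant ⟨a, 0, ha⟩

/-- Over one period the energy changes by exactly `-2πβn`, and friction requires a strict loss. -/
theorem winding_pos (hγ : 0 < γ) (hβ : 0 ≤ β) (h : IsCylinderCycle γ β n φ z) : 0 < n := by
  obtain ⟨T, hT, hper⟩ := h.periodic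
  by_contra! hn
  refine h.not_at_rest (h.sol.eq_const_of_energy_le hγ hT ?_)
  have hp := hper 0
  rw [zero_add] at hp
  rw [hp.1, hp.2, pendulumPotential_add]
  have hn' : (n : ℝ) ≤ 0 := by exact_mod_cast hn
  have := mul_nonneg (mul_nonneg Real.two_pi_pos.le hβ) (neg_nonneg.2 hn')
  linarith

/-- A cycle advances without bound. -/
theorem exists_phi_gt (hγ : 0 < γ) (hβ : 0 ≤ β) (h : IsCylinderCycle γ β n φ z) (a t₀ : ℝ) :
    ∃ t, t₀ < t ∧ a < φ t := by
  obtain ⟨T, hT, hper⟩ := h.periodic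
  have hn : (1 : ℝ) ≤ n := by exact_mod_cast h.winding_pos hγ hβ
  have hk : ∀ k : ℕ, φ (t₀ + k * T) = φ t₀ + k * (2 * Real.pi * n) := by
    intro k
    induction k with
    | zero => simp
    | succ k ih =>
      have := (hper (t₀ + k * T)).1
      push_cast
      rw [show t₀ + (k + 1 : ℝ) * T = t₀ + k * T + T by ring, this, ih]
      ring
  obtain ⟨k, hk'⟩ := exists_nat_gt (max 0 (a - φ t₀))
  have hk0 : (0 : ℝ) < k := (le_max_left _ _).trans_lt hk'
  refine ⟨t₀ + k * T, by nlinarith [mul_pos hk0 hT], ?_⟩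
  rw [hk]
  have h1 : a - φ t₀ < k := (le_max_right _ _).trans_lt hk'
  have h2 : (1 : ℝ) ≤ 2 * Real.pi * n := by nlinarith [Real.pi_gt_three]
  nlinarith

theorem exists_phi_lt (hγ : 0 < γ) (hβ : 0 ≤ β) (h : IsCylinderCycle γ β n φ z) (a t₀ : ℝ) :
    ∃ t, t < t₀ ∧ φ t < a := by
  obtain ⟨T, hT, hper⟩ := h.periodic
  have hn : (1 : ℝ) ≤ n := by exact_mod_cast h.winding_pos hγ hβ
  have hk : ∀ k : ℕ, φ (t₀ - k * T) = φ t₀ - k * (2 * Real.pi * n) := by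
    intro k
    induction k with
    | zero => simp
    | succ k ih =>
      have := (hper (t₀ - (k + 1) * T)).1
      push_cast
      rw [show t₀ - (k + 1 : ℝ) * T + T = t₀ - k * T by ring, ih] at this
      linarith
  obtain ⟨k, hk'⟩ := exists_nat_gt (max 0 (φ t₀ - a))
  have hk0 : (0 : ℝ) < k := (le_max_left _ _).trans_lt hk'
  refine ⟨t₀ - k * T, by nlinarith [mul_pos hk0 hT], ?_⟩
  rw [hk]
  have h1 : φ t₀ - a < k := (le_max_right _ _).trans_lt hk'
  have h2 : (1 : ℝ) ≤ 2 * Real.pi * n := by nlinarith [Real.pi_gt_three]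
  nlinarith

/-- On a cycle `φ` takes every value. -/
theorem exists_phi_eq (hγ : 0 < γ) (hβ : 0 ≤ β) (h : IsCylinderCycle γ β n φ z) (a : ℝ) :
    ∃ t, φ t = a := by
  obtain ⟨t₁, -, h₁⟩ := h.exists_phi_lt hγ hβ a 0
  obtain ⟨t₂, -, h₂⟩ := h.exists_phi_gt hγ hβ a 0
  exact mem_range_of_exists_le_of_exists_ge h.sol.continuous_phi ⟨t₁, h₁.le⟩ ⟨t₂, h₂.le⟩

/-- Since `φ` is unbounded below in the past, a time with `z < 0` is preceded by one with `z > 0`,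
so there is a turning point between them. Since `φ` is unbounded above in the future, its value at
the turning point is taken again, which dissipation forbids. -/
theorem pos (hγ : 0 < γ) (hβ : 0 ≤ β) (h : IsCylinderCycle γ β n φ z) (t : ℝ) : 0 < z t := by
  by_contra! hneg
  obtain ⟨t₁, ht₁⟩ := h.sol.exists_neg h.not_at_rest hneg
  obtain ⟨t₀, h01, ht₀⟩ : ∃ t₀, t₀ < t₁ ∧ 0 < z t₀ := by
    by_contra! hcon
    have hanti : AntitoneOn φ (Set.Iic t₁) :=
      antitoneOn_of_hasDerivAt_nonpos (convex_Iic t₁) h.sol.deriv_phi fun s hs => by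
        rw [interior_Iic] at hs; exact hcon s hs
    obtain ⟨r, hr, hr'⟩ := h.exists_phi_lt hγ hβ (φ t₁) t₁
    exact absurd (hanti hr.le (le_refl t₁) hr.le) (not_le.2 hr')
  obtain ⟨m, hm, hzm, hmax⟩ := h.sol.exists_turning h01 ht₀ ht₁
  obtain ⟨r, hr1, hr⟩ := h.exists_phi_gt hγ hβ (φ m) t₁
  obtain ⟨q, hq, hqm⟩ := intermediate_value_Icc hr1.le h.sol.continuous_phi.continuousOn
    (show φ m ∈ Set.Icc (φ t₁) (φ r) from ⟨hmax _ ⟨h01.le, le_rfl⟩, hr.le⟩)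
  exact h.not_at_rest (h.sol.eq_const_of_return hγ (hm.2.trans_le hq.1) hzm hqm)

end IsCylinderCycle

/-! ### Periodic orbits as graphs -/

/-- `y ≥ 0` is a `2π`-periodic solution of the orbit equation, in the form
`(y² / 2)' = β - sin x - γ y` that makes sense at the zeros of `y`. -/
structure IsNonnegGraph (γ β : ℝ) (y : ℝ → ℝ) : Prop where
  nonneg : ∀ x, 0 ≤ y x
  periodic : Function.Periodic y (2 * Real.pi)
  deriv_sq : ∀ x, HasDerivAt (fun x => y x ^ 2 / 2) (β - Real.sin x - γ * y x) x

namespace IsNonnegGraph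

variable {γ β β' : ℝ} {y w : ℝ → ℝ}

theorem continuous_sq (h : IsNonnegGraph γ β y) : Continuous fun x => y x ^ 2 / 2 :=
  continuous_iff_continuousAt.2 fun x => (h.deriv_sq x).continuousAt

theorem continuous (h : IsNonnegGraph γ β y) : Continuous y := by
  have : y = fun x => √(2 * (y x ^ 2 / 2)) := by
    funext x
    rw [mul_div_cancel₀ _ two_ne_zero, Real.sqrt_sq (h.nonneg x)]
  rw [this]
  exact (continuous_const.mul h.continuous_sq).sqrt

theorem hasDerivAt (h : IsNonnegGraph γ β y) {x : ℝ} (hx : 0 < y x) :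
    HasDerivAt y ((β - Real.sin x) / y x - γ) x := by
  have h1 := ((h.deriv_sq x).const_mul 2).sqrt (by positivity)
  have h2 : (fun x => √(2 * (y x ^ 2 / 2))) = y := by
    funext x
    rw [mul_div_cancel₀ _ two_ne_zero, Real.sqrt_sq (h.nonneg x)]
  rw [h2] at h1
  refine h1.congr_deriv ?_
  rw [mul_div_cancel₀ _ two_ne_zero, Real.sqrt_sq hx.le]
  field_simp

theorem isPeriodicGraph (h : IsNonnegGraph γ β y) (hpos : ∀ x, 0 < y x) :
    IsPeriodicGraph γ β y :=
  ⟨fun x => (hpos x).ne', fun x => h.hasDerivAt (hpos x), h.periodic⟩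

theorem hasDerivAt_energy (h : IsNonnegGraph γ β y) (x : ℝ) :
    HasDerivAt (fun x => y x ^ 2 / 2 + pendulumPotential β x) (-(γ * y x)) x :=
  ((h.deriv_sq x).add (hasDerivAt_pendulumPotential β x)).congr_deriv (by ring)

theorem antitone_energy (hγ : 0 < γ) (h : IsNonnegGraph γ β y) :
    Antitone fun x => y x ^ 2 / 2 + pendulumPotential β x :=
  antitone_of_hasDerivAt_nonpos h.hasDerivAt_energy fun x => by
    simpa using mul_nonneg hγ.le (h.nonneg x)

/-- Without positive drive the potential does not drop over a period, so friction has nothing to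
dissipate and `y` vanishes on a whole period. The equation then forces `β = sin x` throughout it,
which fails at `π/2`. -/
theorem drive_pos (hγ : 0 < γ) (h : IsNonnegGraph γ β y) : 0 < β := by
  by_contra! hβ
  have hanti := h.antitone_energy hγ
  have hends : y 0 ^ 2 / 2 + pendulumPotential β 0 ≤
      y (2 * Real.pi) ^ 2 / 2 + pendulumPotential β (2 * Real.pi) := by
    have h1 := pendulumPotential_add β 0 1
    have h2 := h.periodic 0
    simp only [Int.cast_one, mul_one, zero_add] at h1 h2
    rw [h1, h2]
    nlinarith [Real.two_pi_pos]
  have hz : ∀ x ∈ Set.Ioo 0 (2 * Real.pi), y x = 0 := by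
    intro x hx
    have hev : (fun x => y x ^ 2 / 2 + pendulumPotential β x) =ᶠ[𝓝 x]
        fun _ => y 0 ^ 2 / 2 + pendulumPotential β 0 := by
      filter_upwards [Ioo_mem_nhds hx.1 hx.2] with s hs
      exact le_antisymm (hanti hs.1.le) (hends.trans (hanti hs.2.le))
    have h0 := (h.hasDerivAt_energy x).unique
      ((hasDerivAt_const x _).congr_of_eventuallyEq hev)
    simpa [hγ.ne'] using h0
  have hmem : Real.pi / 2 ∈ Set.Ioo 0 (2 * Real.pi) :=
    ⟨by linarith [Real.pi_pos], by linarith [Real.pi_pos]⟩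
  have hev : (fun x => y x ^ 2 / 2) =ᶠ[𝓝 (Real.pi / 2)] fun _ => 0 := by
    filter_upwards [Ioo_mem_nhds hmem.1 hmem.2] with s hs
    rw [hz s hs]; norm_num
  have h0 := (h.deriv_sq _).unique ((hasDerivAt_const _ _).congr_of_eventuallyEq hev)
  rw [hz _ hmem, Real.sin_pi_div_two] at h0
  linarith

/-- A periodic subsolution lies below a periodic solution. -/
theorem sub_le (hγ : 0 < γ) (h : IsNonnegGraph γ β y) {p' : ℝ → ℝ} (hw : ∀ x, 0 ≤ w x)
    (hwp : Function.Periodic w (2 * Real.pi)) (hwd : ∀ x, HasDerivAt (fun x => w x ^ 2 / 2) (p' x) x)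
    (hsub : ∀ x, p' x ≤ β - Real.sin x - γ * w x) (x : ℝ) : w x ≤ y x := by
  have hd : ∀ x, HasDerivAt (fun x => y x ^ 2 / 2 - w x ^ 2 / 2) _ x :=
    fun x => (h.deriv_sq x).sub (hwd x)
  obtain ⟨m, hm⟩ := Function.Periodic.exists_isMin Real.two_pi_pos
    (f := fun x => y x ^ 2 / 2 - w x ^ 2 / 2) (fun x => by simp only [h.periodic x, hwp x])
    (continuous_iff_continuousAt.2 fun x => (hd x).continuousAt)
  -- Equal derivatives at the minimum `m` turn the subsolution inequality into `γ w ≤ γ y` there, so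
  -- the minimum of the difference is nonnegative.
  have h0 := deriv_eq_zero_of_forall_le hm (hd m)
  have h1 : w m ≤ y m := by
    have := hsub m
    exact le_of_mul_le_mul_left (by linarith) hγ
  have h2 := hm x
  have h3 : w m ^ 2 ≤ y m ^ 2 := pow_le_pow_left₀ (hw m) h1 2
  exact le_of_sq_le_sq (by linarith) (h.nonneg x)

theorem lt_of_drive_lt (hγ : 0 < γ) (h : IsNonnegGraph γ β y) (h' : IsNonnegGraph γ β' w)
    (hβ : β < β') (x : ℝ) : y x < w x := by
  have hd : ∀ x, HasDerivAt (fun x => w x ^ 2 / 2 - y x ^ 2 / 2) _ x :=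
    fun x => (h'.deriv_sq x).sub (h.deriv_sq x)
  obtain ⟨m, hm⟩ := Function.Periodic.exists_isMin Real.two_pi_pos
    (f := fun x => w x ^ 2 / 2 - y x ^ 2 / 2) (fun x => by simp only [h.periodic x, h'.periodic x])
    (continuous_iff_continuousAt.2 fun x => (hd x).continuousAt)
  have h0 := deriv_eq_zero_of_forall_le hm (hd m)
  have h1 : y m < w m := lt_of_mul_lt_mul_left (by linarith) hγ.le
  have h2 := hm x
  have h3 : y m ^ 2 < w m ^ 2 := pow_lt_pow_left₀ h1 (h.nonneg m) two_ne_zero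
  exact lt_of_pow_lt_pow_left₀ 2 (h'.nonneg x) (by linarith)

theorem eq (hγ : 0 < γ) (h : IsNonnegGraph γ β y) (h' : IsNonnegGraph γ β w) : y = w :=
  funext fun x => le_antisymm
    (h'.sub_le hγ h.nonneg h.periodic h.deriv_sq (fun _ => le_rfl) x)
    (h.sub_le hγ h'.nonneg h'.periodic h'.deriv_sq (fun _ => le_rfl) x)

/-- This bounds the slope of `y` independently of `β` and of how close `y` comes to zero, which is
what the limit `β ↓ β₀` needs. If the bound failed where `(1 + γ) y ∓ (β - sin x)` is smallest, the
slope of `y` would be too large to be balanced by a cosine. -/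
theorem abs_le (hγ : 0 < γ) (h : IsNonnegGraph γ β y) (hpos : ∀ x, 0 < y x) (x : ℝ) :
    |β - Real.sin x| ≤ (1 + γ) * y x := by
  have hderiv : ∀ ε : ℝ, ∀ x, HasDerivAt (fun x => (1 + γ) * y x - ε * (β - Real.sin x))
      ((1 + γ) * ((β - Real.sin x) / y x - γ) - ε * (0 - Real.cos x)) x := fun ε x =>
    ((h.hasDerivAt (hpos x)).const_mul _).sub
      (((hasDerivAt_const x β).sub (Real.hasDerivAt_sin x)).const_mul ε)
  have key : ∀ ε : ℝ, ε = 1 ∨ ε = -1 → ∀ x, ε * (β - Real.sin x) ≤ (1 + γ) * y x := by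
    intro ε hε x
    obtain ⟨m, hm⟩ := Function.Periodic.exists_isMin Real.two_pi_pos
      (f := fun x => (1 + γ) * y x - ε * (β - Real.sin x))
      (fun x => by simp only [h.periodic x, Real.sin_add_two_pi])
      (continuous_iff_continuousAt.2 fun x => (hderiv ε x).continuousAt)
    have h0 := deriv_eq_zero_of_forall_le hm (hderiv ε m)
    have hy := hpos m
    suffices hs : ε * (β - Real.sin m) ≤ (1 + γ) * y m by linarith [hm x]
    by_contra! hcon
    have h2 : (1 + γ) < ε * ((β - Real.sin m) / y m) := by
      rw [mul_div_assoc', lt_div_iff₀ hy]; exact hcon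
    have h3 := Real.cos_le_one m
    have h4 := Real.neg_one_le_cos m
    rcases hε with rfl | rfl <;> nlinarith
  rw [_root_.abs_le]
  constructor
  · linarith [key (-1) (Or.inr rfl) x]
  · linarith [key 1 (Or.inl rfl) x]

theorem lipschitz (hγ : 0 < γ) (h : IsNonnegGraph γ β y) (hpos : ∀ x, 0 < y x) :
    LipschitzWith (Real.toNNReal (1 + 2 * γ)) y := by
  refine lipschitzWith_of_nnnorm_deriv_le
    (fun x => (h.hasDerivAt (hpos x)).differentiableAt) fun x => ?_
  rw [← NNReal.coe_le_coe, coe_nnnorm, (h.hasDerivAt (hpos x)).deriv,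
    Real.coe_toNNReal _ (by linarith), Real.norm_eq_abs]
  have h1 : |(β - Real.sin x) / y x| ≤ 1 + γ := by
    rw [abs_div, abs_of_pos (hpos x), div_le_iff₀ (hpos x)]
    exact h.abs_le hγ hpos x
  calc _ ≤ |(β - Real.sin x) / y x| + |γ| := abs_sub _ _
    _ ≤ _ := by rw [abs_of_pos hγ]; linarith

end IsNonnegGraph

namespace IsPeriodicGraph

variable {γ β : ℝ} {y : ℝ → ℝ}

theorem continuous (h : IsPeriodicGraph γ β y) : Continuous y :=
  continuous_iff_continuousAt.2 fun x => (h.deriv x).continuousAt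

theorem deriv_sq (h : IsPeriodicGraph γ β y) (x : ℝ) :
    HasDerivAt (fun x => y x ^ 2 / 2) (β - Real.sin x - γ * y x) x := by
  refine (((h.deriv x).pow 2).div_const 2).congr_deriv ?_
  have := h.ne_zero x
  simp
  field_simp

/-- A graph without zeros has one sign. If it were negative, the energy would strictly increase in
`x`, but over a period it changes by `-2πβ ≤ 0`. -/
theorem pos (hγ : 0 < γ) (hβ : 0 ≤ β) (h : IsPeriodicGraph γ β y) (x : ℝ) : 0 < y x := by
  by_contra! hx
  have hneg : ∀ t, y t < 0 := by
    intro t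
    by_contra! ht
    obtain ⟨c, hc⟩ := mem_range_of_exists_le_of_exists_ge h.continuous ⟨x, hx⟩ ⟨t, ht⟩
    exact h.ne_zero c hc
  have hd : ∀ x, HasDerivAt (fun x => y x ^ 2 / 2 + pendulumPotential β x) (-(γ * y x)) x :=
    fun x => ((h.deriv_sq x).add (hasDerivAt_pendulumPotential β x)).congr_deriv (by ring)
  have hmono : StrictMono fun x => y x ^ 2 / 2 + pendulumPotential β x :=
    strictMono_of_deriv_pos fun x => by
      rw [(hd x).deriv]
      nlinarith [hneg x]
  have h1 := hmono Real.two_pi_pos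
  have h2 := h.periodic 0
  have h3 := pendulumPotential_add β 0 1
  simp only [Int.cast_one, mul_one, zero_add] at h1 h2 h3
  rw [h2, h3] at h1
  nlinarith [Real.two_pi_pos]

theorem isNonnegGraph (h : IsPeriodicGraph γ β y) (hpos : ∀ x, 0 < y x) :
    IsNonnegGraph γ β y :=
  ⟨fun x => (hpos x).le, h.periodic, h.deriv_sq⟩

end IsPeriodicGraph

/-! ### Existence of periodic orbits -/

/-- A regularized version of `√(2 q)`, with values in `[a, b]`. -/
noncomputable def clampedSpeed (a b q : ℝ) : ℝ := √(2 * max (a ^ 2 / 2) (min q (b ^ 2 / 2)))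

section clampedSpeed

variable {a b q : ℝ}

theorem le_clampedSpeed : a ≤ clampedSpeed a b q := by
  refine Real.le_sqrt_of_sq_le ?_
  linarith [le_max_left (a ^ 2 / 2) (min q (b ^ 2 / 2))]

theorem clampedSpeed_le (ha : 0 < a) (hab : a ≤ b) : clampedSpeed a b q ≤ b := by
  refine Real.sqrt_le_iff.2 ⟨by linarith, ?_⟩
  have : max (a ^ 2 / 2) (min q (b ^ 2 / 2)) ≤ b ^ 2 / 2 :=
    max_le (by nlinarith) (min_le_right _ _)
  linarith

theorem clampedSpeed_of_le (ha : 0 < a) (hq : q ≤ a ^ 2 / 2) : clampedSpeed a b q = a := by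
  rw [clampedSpeed, max_eq_left ((min_le_left _ _).trans hq), mul_div_cancel₀ _ two_ne_zero,
    Real.sqrt_sq ha.le]

theorem clampedSpeed_of_ge (ha : 0 < a) (hab : a ≤ b) (hq : b ^ 2 / 2 ≤ q) :
    clampedSpeed a b q = b := by
  rw [clampedSpeed, min_eq_right hq, max_eq_right (by nlinarith), mul_div_cancel₀ _ two_ne_zero,
    Real.sqrt_sq (by linarith)]

theorem clampedSpeed_sq (h₁ : a ^ 2 / 2 ≤ q) (h₂ : q ≤ b ^ 2 / 2) :
    clampedSpeed a b q ^ 2 / 2 = q := by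
  have hq : 0 ≤ q := by nlinarith [sq_nonneg a]
  rw [clampedSpeed, min_eq_left h₂, max_eq_right h₁, Real.sq_sqrt (by linarith)]
  ring

/-- The lower clamp removes the singularity of the square root: `|u - v| (u + v) = |u² - v²| ≤ 2 |p
- q|` and `u + v ≥ 2a`. -/
theorem lipschitz_clampedSpeed (ha : 0 < a) (p q : ℝ) :
    |clampedSpeed a b p - clampedSpeed a b q| ≤ a⁻¹ * |p - q| := by
  set u := clampedSpeed a b p with hu
  set v := clampedSpeed a b q with hv
  have hu1 : a ≤ u := le_clampedSpeed
  have hv1 : a ≤ v := le_clampedSpeed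
  have hc : |max (a ^ 2 / 2) (min p (b ^ 2 / 2)) - max (a ^ 2 / 2) (min q (b ^ 2 / 2))|
      ≤ |p - q| := by
    refine (abs_max_sub_max_le_max _ _ _ _).trans (max_le (by simp) ?_)
    exact (abs_min_sub_min_le_max _ _ _ _).trans (by simp)
  have hnn : ∀ q : ℝ, 0 ≤ 2 * max (a ^ 2 / 2) (min q (b ^ 2 / 2)) := fun q => by
    have := le_max_left (a ^ 2 / 2) (min q (b ^ 2 / 2))
    nlinarith [sq_nonneg a]
  have hu2 := Real.sq_sqrt (hnn p)
  have hv2 := Real.sq_sqrt (hnn q)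
  change u ^ 2 = _ at hu2
  change v ^ 2 = _ at hv2
  have h1 : |u - v| * (u + v) ≤ 2 * |p - q| := by
    rw [← abs_of_pos (show 0 < u + v by linarith), ← abs_mul,
      show (u - v) * (u + v) = 2 * (max (a ^ 2 / 2) (min p (b ^ 2 / 2)) -
        max (a ^ 2 / 2) (min q (b ^ 2 / 2))) by linear_combination hu2 - hv2, abs_mul]
    simpa using hc
  rw [inv_mul_eq_div, le_div_iff₀ ha]
  nlinarith [abs_nonneg (u - v)]

end clampedSpeed

/-- Fixed point of the Poincaré map of the regularized equation. -/
theorem exists_periodic_clamped {γ β a b : ℝ} (hγ : 0 < γ) (ha : 0 < a) (hab : a ≤ b)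
    (h₁ : γ * a ≤ β) (h₂ : β ≤ γ * b) :
    ∃ q : ℝ → ℝ, Function.Periodic q (2 * Real.pi) ∧
      ∀ x, HasDerivAt q (β - Real.sin x - γ * clampedSpeed a b (q x)) x := by
  set f : ℝ → ℝ → ℝ := fun x q => β - Real.sin x - γ * clampedSpeed a b q with hf
  set K : NNReal := Real.toNNReal (γ * a⁻¹) with hK
  have hKc : (K : ℝ) = γ * a⁻¹ := Real.coe_toNNReal _ (by positivity)
  have hLip : ∀ t, LipschitzWith K (f t) := fun t => LipschitzWith.of_dist_le_mul fun p q => by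
    rw [Real.dist_eq, Real.dist_eq, hKc, show f t p - f t q =
      -(γ * (clampedSpeed a b p - clampedSpeed a b q)) by simp only [hf]; ring, abs_neg, abs_mul,
      abs_of_pos hγ, mul_assoc]
    exact mul_le_mul_of_nonneg_left (lipschitz_clampedSpeed ha p q) hγ.le
  have hcont : ∀ q, Continuous fun t => f t q := fun q => by simp only [hf]; fun_prop
  have hβ : 0 < β := (mul_pos hγ ha).trans_le h₁
  set M : NNReal := Real.toNNReal (β + 1 + γ * b) with hM
  have hMc : (M : ℝ) = β + 1 + γ * b := Real.coe_toNNReal _ (by nlinarith)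
  have hbound : ∀ t q, |f t q| ≤ M := fun t q => by
    have h3 := mul_le_mul_of_nonneg_left (clampedSpeed_le (q := q) ha hab) hγ.le
    have h4 := mul_pos hγ (ha.trans_le (le_clampedSpeed (b := b) (q := q)))
    rw [hMc, abs_le]
    constructor <;> simp only [hf] <;> linarith [Real.neg_one_le_sin t, Real.sin_le_one t]
  choose Q hQ0 hQ using exists_global_solution hLip hcont hbound
  have hπ := Real.two_pi_pos
  have hPcont : Continuous fun c => Q c (2 * Real.pi) := by
    have : LipschitzWith (Real.toNNReal (Real.exp (K * (2 * Real.pi - 0))))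
        fun c => Q c (2 * Real.pi) := LipschitzWith.of_dist_le_mul fun c d => by
      rw [Real.coe_toNNReal _ (Real.exp_pos _).le, mul_comm (Real.exp _)]
      exact dist_le_of_trajectories_ODE (v := f) (K := K) (a := 0) (b := 2 * Real.pi) hLip
        (fun t _ => (hQ c t).continuousAt.continuousWithinAt)
        (fun t _ => (hQ c t).hasDerivWithinAt)
        (fun t _ => (hQ d t).continuousAt.continuousWithinAt)
        (fun t _ => (hQ d t).hasDerivWithinAt)
        (by rw [hQ0, hQ0]) _ ⟨hπ.le, le_rfl⟩
    exact this.continuous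
  have hdist : ∀ c, ∀ x ∈ Set.Icc 0 (2 * Real.pi), |Q c x - c| ≤ M * (2 * Real.pi) := by
    intro c x hx
    have h3 := Convex.norm_image_sub_le_of_norm_hasDerivWithin_le (f := Q c) (C := M)
      (s := Set.univ) (x := 0) (y := x) (fun t _ => (hQ c t).hasDerivWithinAt)
      (fun t _ => hbound _ _) convex_univ trivial trivial
    rw [hQ0, Real.norm_eq_abs, Real.norm_eq_abs, sub_zero, abs_of_nonneg hx.1] at h3
    exact h3.trans (mul_le_mul_of_nonneg_left hx.2 M.2)
  -- While the speed is frozen at `d` the equation integrates explicitly.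
  have hconst : ∀ c d, (∀ x ∈ Set.Icc 0 (2 * Real.pi), clampedSpeed a b (Q c x) = d) →
      Q c (2 * Real.pi) = c + 2 * Real.pi * (β - γ * d) := by
    intro c d hd
    have hder : ∀ x, HasDerivAt (fun x => Q c x + pendulumPotential β x + γ * d * x)
        (f x (Q c x) + (Real.sin x - β) + γ * d) x := fun x =>
      (((hQ c x).add (hasDerivAt_pendulumPotential β x)).add
        ((hasDerivAt_id x).const_mul (γ * d))).congr_deriv (by simp)
    have h3 := constant_of_has_deriv_right_zero
      (f := fun x => Q c x + pendulumPotential β x + γ * d * x) (a := 0) (b := 2 * Real.pi)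
      (fun x _ => (hder x).continuousAt.continuousWithinAt)
      (fun x hx => ((hder x).congr_deriv (by
        simp only [hf, hd x (Set.Ico_subset_Icc_self hx)]; ring)).hasDerivWithinAt)
      (2 * Real.pi) ⟨hπ.le, le_rfl⟩
    have h4 := pendulumPotential_add β 0 1
    simp only [Int.cast_one, mul_one, zero_add] at h4
    simp only [hQ0, h4] at h3
    linear_combination h3
  -- A solution moves by at most `2πM` over a period. Started that far above `b²/2` it stays clamped
  -- at `b` and is displaced by `2π(β - γb) ≤ 0`. Started that far below `a²/2` it is displaced by
  -- `2π(β - γa) ≥ 0`.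
  obtain ⟨c, hc⟩ : ∃ c, Q c (2 * Real.pi) - c = 0 := by
    refine mem_range_of_exists_le_of_exists_ge (f := fun c => Q c (2 * Real.pi) - c)
      (hPcont.sub continuous_id) ⟨b ^ 2 / 2 + M * (2 * Real.pi), ?_⟩
      ⟨a ^ 2 / 2 - M * (2 * Real.pi), ?_⟩
    · rw [hconst _ b fun x hx => clampedSpeed_of_ge ha hab
        (by linarith [(abs_le.1 (hdist (b ^ 2 / 2 + M * (2 * Real.pi)) x hx)).1])]
      nlinarith
    · rw [hconst _ a fun x hx => clampedSpeed_of_le ha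
        (by linarith [(abs_le.1 (hdist (a ^ 2 / 2 - M * (2 * Real.pi)) x hx)).2])]
      nlinarith
  have hshift : (fun x => Q c (x + 2 * Real.pi)) = Q c := by
    refine solution_unique hLip (t₀ := 0) (fun x => ?_) (hQ c) ?_
    · have := (hQ c (x + 2 * Real.pi)).comp_add_const x (2 * Real.pi)
      simpa only [hf, Real.sin_add_two_pi] using this
    · rw [zero_add, hQ0]; linarith
  exact ⟨Q c, fun x => congrFun hshift x, hQ c⟩

/-- A positive periodic subsolution of the orbit equation yields a positive periodic solution. -/
theorem exists_graph_of_sub {γ β : ℝ} (hγ : 0 < γ) {w p' : ℝ → ℝ} (hw : ∀ x, 0 < w x)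
    (hwc : Continuous w) (hwp : Function.Periodic w (2 * Real.pi))
    (hwd : ∀ x, HasDerivAt (fun x => w x ^ 2 / 2) (p' x) x)
    (hsub : ∀ x, p' x ≤ β - Real.sin x - γ * w x) :
    ∃ y, IsNonnegGraph γ β y ∧ ∀ x, 0 < y x := by
  obtain ⟨xm, hxm⟩ := hwp.exists_isMin Real.two_pi_pos hwc
  obtain ⟨xM, hxM⟩ := hwp.exists_isMax Real.two_pi_pos hwc
  set a := w xm / 2 with ha'
  have ha : 0 < a := half_pos (hw xm)
  have hwa : ∀ x, a < w x := fun x => (half_lt_self (hw xm)).trans_le (hxm x)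
  have haβ : γ * a ≤ β := by
    have hd : ∀ x, HasDerivAt (fun x => w x ^ 2 / 2 + pendulumPotential β x + γ * a * x)
        (p' x + (Real.sin x - β) + γ * a) x := fun x =>
      (((hwd x).add (hasDerivAt_pendulumPotential β x)).add
        ((hasDerivAt_id x).const_mul (γ * a))).congr_deriv (by simp)
    have hanti := antitone_of_hasDerivAt_nonpos hd fun x => by
      have := mul_lt_mul_of_pos_left (hwa x) hγ
      simp only [Pi.zero_apply]
      linarith [hsub x]
    -- The drop of this function over a period gives `2πγa ≤ 2πβ`.
    have h1 := hanti Real.two_pi_pos.le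
    have h2 := hwp 0
    have h3 := pendulumPotential_add β 0 1
    simp only [Int.cast_one, mul_one, zero_add] at h1 h2 h3
    rw [h2, h3] at h1
    have h4 : 2 * Real.pi * (γ * a) ≤ 2 * Real.pi * β := by linarith
    exact le_of_mul_le_mul_left h4 Real.two_pi_pos
  -- The clamps `a` and `b` enclose `w` strictly. The extra `(β + 1)/γ` makes `γ b > β + 1 ≥ β - sin
  -- x`, so `q` cannot have a maximum above `b²/2`. Thus the clamping turns out to be inactive.
  set b := w xM + (β + 1) / γ with hb'
  have hβ : 0 < β := (mul_pos hγ ha).trans_le haβ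
  have hbγ : γ * b = γ * w xM + (β + 1) := by rw [hb']; field_simp
  have hwb : ∀ x, w x < b := fun x => by
    have : 0 < (β + 1) / γ := by positivity
    rw [hb']; linarith [hxM x]
  have hbβ : β + 1 < γ * b := by rw [hbγ]; linarith [mul_pos hγ (hw xM)]
  have hab : a ≤ b := ((hwa xm).trans (hwb xm)).le
  obtain ⟨q, hqp, hq⟩ := exists_periodic_clamped hγ ha hab haβ (by linarith)
  have hqc : Continuous q := continuous_iff_continuousAt.2 fun x => (hq x).continuousAt
  have hwb2 : ∀ x, w x ^ 2 / 2 < b ^ 2 / 2 := fun x => by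
    linarith [pow_lt_pow_left₀ (hwb x) (hw x).le two_ne_zero]
  have hwa2 : ∀ x, a ^ 2 / 2 < w x ^ 2 / 2 := fun x => by
    linarith [pow_lt_pow_left₀ (hwa x) ha.le two_ne_zero]
  have hlow : ∀ x, a ^ 2 / 2 ≤ q x := by
    have hd : ∀ x, HasDerivAt (fun x => q x - w x ^ 2 / 2) _ x := fun x => (hq x).sub (hwd x)
    obtain ⟨m, hm⟩ := Function.Periodic.exists_isMin Real.two_pi_pos
      (f := fun x => q x - w x ^ 2 / 2) (fun x => by simp only [hqp x, hwp x])
      (continuous_iff_continuousAt.2 fun x => (hd x).continuousAt)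
    have h0 := deriv_eq_zero_of_forall_le hm (hd m)
    have h1 : w m ≤ clampedSpeed a b (q m) := le_of_mul_le_mul_left (by linarith [hsub m]) hγ
    have h2 : w m ^ 2 / 2 ≤ q m := by
      by_contra! hlt
      rcases le_total (q m) (a ^ 2 / 2) with h | h
      · rw [clampedSpeed_of_le ha h] at h1
        exact absurd (hwa m) (not_lt.2 h1)
      · have h3 := clampedSpeed_sq h (hlt.trans (hwb2 m)).le
        have h4 := pow_le_pow_left₀ (hw m).le h1 2
        linarith
    exact fun x => by linarith [hm x, hwa2 x]
  have hupp : ∀ x, q x ≤ b ^ 2 / 2 := by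
    obtain ⟨m, hm⟩ := hqp.exists_isMax Real.two_pi_pos hqc
    have h0 := deriv_eq_zero_of_forall_ge hm (hq m)
    by_contra! hcon
    obtain ⟨x, hx⟩ := hcon
    rw [clampedSpeed_of_ge ha hab (hx.trans_le (hm x)).le] at h0
    linarith [Real.neg_one_le_sin m]
  have hpos : ∀ x, 0 < clampedSpeed a b (q x) := fun x => ha.trans_le (le_clampedSpeed)
  refine ⟨fun x => clampedSpeed a b (q x), ⟨fun x => (hpos x).le,
    fun x => by simp only [hqp x], fun x => ?_⟩, hpos⟩
  have : (fun x => clampedSpeed a b (q x) ^ 2 / 2) = q :=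
    funext fun x => clampedSpeed_sq (hlow x) (hupp x)
  rw [this]
  exact hq x

/-! ### The critical drive -/

/-- The drives for which there is a positive periodic orbit. -/
def runningDrives (γ : ℝ) : Set ℝ := {β | ∃ y, IsNonnegGraph γ β y ∧ ∀ x, 0 < y x}

/-- The infimum of the drives with a positive periodic orbit. -/
noncomputable def criticalDrive (γ : ℝ) : ℝ := sInf (runningDrives γ)

/-- The constant `(β - 1)/γ` is a subsolution, with equality where `sin x = 1`. -/
theorem mem_runningDrives_of_one_lt {γ β : ℝ} (hγ : 0 < γ) (hβ : 1 < β) :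
    β ∈ runningDrives γ := by
  have hw : 0 < (β - 1) / γ := div_pos (by linarith) hγ
  refine exists_graph_of_sub hγ (w := fun _ => (β - 1) / γ) (p' := fun _ => 0) (fun _ => hw)
    continuous_const (fun _ => rfl) (fun x => hasDerivAt_const _ _) fun x => ?_
  rw [mul_div_cancel₀ _ hγ.ne']
  linarith [Real.sin_le_one x]

/-- A positive graph is a subsolution for any larger drive and smaller friction. -/
theorem mem_runningDrives_of_le {γ γ' β β' : ℝ} (hγ' : 0 < γ') (hγ : γ' ≤ γ) (hβ : β ≤ β')
    (h : β ∈ runningDrives γ) : β' ∈ runningDrives γ' := by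
  obtain ⟨y, hy, hpos⟩ := h
  refine exists_graph_of_sub hγ' hpos hy.continuous hy.periodic hy.deriv_sq fun x => ?_
  nlinarith [hpos x]

/-- Subtracting a constant from `y²` keeps the derivative of the half-square but lowers the friction
term. With `w² = y² - m²/2` one has `(y - w)(y + w) = m²/2` and `y + w ≤ 2M`, hence `y - w ≥
m²/(4M)`. This gain pays for the smaller drive. -/
theorem exists_lt_mem_runningDrives {γ β : ℝ} (hγ : 0 < γ) (h : β ∈ runningDrives γ) :
    ∃ β' ∈ runningDrives γ, β' < β := by
  obtain ⟨y, hy, hpos⟩ := h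
  obtain ⟨xm, hxm⟩ := hy.periodic.exists_isMin Real.two_pi_pos hy.continuous
  obtain ⟨xM, hxM⟩ := hy.periodic.exists_isMax Real.two_pi_pos hy.continuous
  set m := y xm with hm
  set M := y xM with hM
  have hm0 : 0 < m := hpos xm
  have hM0 : 0 < M := hpos xM
  have hrad : ∀ x, 0 < y x ^ 2 - m ^ 2 / 2 := fun x => by
    have := pow_le_pow_left₀ hm0.le (hxm x) 2
    nlinarith [pow_pos hm0 2]
  have hsq : ∀ x, √(y x ^ 2 - m ^ 2 / 2) ^ 2 = y x ^ 2 - m ^ 2 / 2 := fun x =>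
    Real.sq_sqrt (hrad x).le
  refine ⟨β - γ * (m ^ 2 / (4 * M)), ?_, by have : 0 < γ * (m ^ 2 / (4 * M)) := by positivity
                                            linarith⟩
  refine exists_graph_of_sub hγ (w := fun x => √(y x ^ 2 - m ^ 2 / 2))
    (p' := fun x => β - Real.sin x - γ * y x) (fun x => Real.sqrt_pos.2 (hrad x))
    (by have := hy.continuous; fun_prop) (fun x => by simp only [hy.periodic x]) (fun x => ?_)
    fun x => ?_
  · have : (fun x => √(y x ^ 2 - m ^ 2 / 2) ^ 2 / 2) = fun x => y x ^ 2 / 2 - m ^ 2 / 4 := by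
      funext x
      rw [hsq]
      ring
    rw [this]
    exact (hy.deriv_sq x).sub_const _
  · set w := √(y x ^ 2 - m ^ 2 / 2) with hw
    have hw0 : 0 < w := Real.sqrt_pos.2 (hrad x)
    have h1 : w ≤ y x := by
      refine le_of_sq_le_sq ?_ (hpos x).le
      rw [hsq x]
      linarith [pow_pos hm0 2]
    have h2 : m ^ 2 / (4 * M) ≤ y x - w := by
      rw [div_le_iff₀ (by positivity)]
      have := hsq x
      nlinarith [hxM x]
    nlinarith

theorem runningDrives_pos {γ β : ℝ} (hγ : 0 < γ) (h : β ∈ runningDrives γ) : 0 < β :=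
  let ⟨_, hy, _⟩ := h
  hy.drive_pos hγ

theorem bddBelow_runningDrives {γ : ℝ} (hγ : 0 < γ) : BddBelow (runningDrives γ) :=
  ⟨0, fun _ h => (runningDrives_pos hγ h).le⟩

theorem nonempty_runningDrives {γ : ℝ} (hγ : 0 < γ) : (runningDrives γ).Nonempty :=
  ⟨2, mem_runningDrives_of_one_lt hγ one_lt_two⟩

theorem mem_runningDrives_iff {γ β : ℝ} (hγ : 0 < γ) :
    β ∈ runningDrives γ ↔ criticalDrive γ < β := by
  constructor
  · intro h
    obtain ⟨β', h', hlt⟩ := exists_lt_mem_runningDrives hγ h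
    exact (csInf_le (bddBelow_runningDrives hγ) h').trans_lt hlt
  · intro h
    obtain ⟨β', h', hlt⟩ := exists_lt_of_csInf_lt (nonempty_runningDrives hγ) h
    exact mem_runningDrives_of_le hγ le_rfl hlt.le h'

theorem criticalDrive_mono {γ γ' : ℝ} (hγ : 0 < γ) (h : γ ≤ γ') :
    criticalDrive γ ≤ criticalDrive γ' :=
  csInf_le_csInf (bddBelow_runningDrives hγ) (nonempty_runningDrives (hγ.trans_le h))
    fun _ hβ => mem_runningDrives_of_le hγ h le_rfl hβ

/-- At the critical drive there is a periodic nonnegative orbit graph, with a zero. -/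
theorem exists_critical_graph {γ : ℝ} (hγ : 0 < γ) :
    ∃ y, IsNonnegGraph γ (criticalDrive γ) y ∧
      LipschitzWith (Real.toNNReal (1 + 2 * γ)) y ∧ ∃ x, y x = 0 := by
  set β₀ := criticalDrive γ with hβ₀
  set b : ℕ → ℝ := fun n => β₀ + 1 / ((n : ℝ) + 1) with hb
  have hbmem : ∀ n, b n ∈ runningDrives γ := fun n =>
    (mem_runningDrives_iff hγ).2 (lt_add_of_pos_right _ Nat.one_div_pos_of_nat)
  have hbanti : StrictAnti b := fun m n hmn => by
    simp only [hb]
    linarith [Nat.one_div_lt_one_div (α := ℝ) hmn]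
  have hblim : Tendsto b atTop (𝓝 β₀) := by
    simpa [hb] using
      (tendsto_one_div_add_atTop_nhds_zero_nat (𝕜 := ℝ)).const_add β₀
  choose Y hY hYpos using hbmem
  have hanti : Antitone Y := fun m n hmn => by
    rcases hmn.eq_or_lt with rfl | h
    · exact le_rfl
    · exact fun x => ((hY n).lt_of_drive_lt hγ (hY m) (hbanti h) x).le
  have hlim : ∀ x, Tendsto (fun n => Y n x) atTop (𝓝 (⨅ n, Y n x)) := fun x =>
    tendsto_atTop_ciInf (fun m n hmn => hanti hmn x)
      ⟨0, by rintro _ ⟨n, rfl⟩; exact (hYpos n x).le⟩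
  set y : ℝ → ℝ := fun x => ⨅ n, Y n x with hy
  have hLip : LipschitzWith (Real.toNNReal (1 + 2 * γ)) y :=
    LipschitzWith.of_dist_le_mul fun p q => le_of_tendsto ((hlim p).dist (hlim q))
      (Eventually.of_forall fun n => ((hY n).lipschitz hγ (hYpos n)).dist_le_mul p q)
  have hgraph : IsNonnegGraph γ β₀ y := by
    refine ⟨fun x => ge_of_tendsto' (hlim x) fun n => (hYpos n x).le,
      fun x => by simp only [hy, (hY _).periodic x], fun x => ?_⟩
    -- Dini's theorem needs monotone derivatives, but `b n` decreases while `-γ Y n` increases. The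
    -- linear term `b n * x` is therefore subtracted before differentiating and its limit is added
    -- back afterwards.
    have hunif : TendstoLocallyUniformly (fun n x => -Real.sin x - γ * Y n x)
        (fun x => -Real.sin x - γ * y x) atTop := by
      refine Monotone.tendstoLocallyUniformly_of_forall_tendsto (fun n => ?_) ?_ ?_ fun x => ?_
      · have := (hY n).continuous
        fun_prop
      · intro m n hmn x
        have := mul_le_mul_of_nonneg_left (hanti hmn x) hγ.le
        simp only
        linarith
      · have := hLip.continuous
        fun_prop
      · exact tendsto_const_nhds.sub ((hlim x).const_mul γ)
    have hd := hasDerivAt_of_tendstoLocallyUniformlyOn (f := fun n x => Y n x ^ 2 / 2 - b n * x)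
      (g := fun x => y x ^ 2 / 2 - β₀ * x) isOpen_univ (tendstoLocallyUniformlyOn_univ.2 hunif)
      (Eventually.of_forall fun n x _ => (((hY n).deriv_sq x).sub
        ((hasDerivAt_id x).const_mul (b n))).congr_deriv (by simp; ring))
      (fun x _ => (((hlim x).pow 2).div_const 2).sub (hblim.mul_const x)) (Set.mem_univ x)
    have hd' := hd.add ((hasDerivAt_id x).const_mul β₀)
    refine (hd'.congr_deriv (by simp; ring)).congr_of_eventuallyEq
      (Eventually.of_forall fun x => ?_)
    simp
  refine ⟨y, hgraph, hLip, ?_⟩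
  by_contra! hne
  -- A limit graph without zeros would make `β₀` a running drive, yet all of these exceed `β₀`.
  exact lt_irrefl β₀ ((mem_runningDrives_iff hγ).1
    ⟨y, hgraph, fun x => lt_of_le_of_ne (hgraph.nonneg x) (hne x).symm⟩)

/-- A nonnegative orbit graph vanishes only at the saddles. -/
theorem IsNonnegGraph.eq_saddle {γ β : ℝ} (hγ : 0 < γ) {y : ℝ → ℝ} (h : IsNonnegGraph γ β y)
    {x : ℝ} (hx : y x = 0) :
    β ≤ 1 ∧ ∃ k : ℤ, x = Real.pi - Real.arcsin β + k * (2 * Real.pi) := by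
  have hsin : β = Real.sin x := by
    have := deriv_eq_zero_of_forall_le
      (fun t => by rw [hx]; nlinarith [sq_nonneg (y t)]) (h.deriv_sq x)
    rw [hx] at this
    linarith
  have hβ1 : β ≤ 1 := hsin ▸ Real.sin_le_one x
  have hβ0 := h.drive_pos hγ
  refine ⟨hβ1, ?_⟩
  set α := Real.arcsin β with hα
  have hsα : Real.sin α = β := Real.sin_arcsin (by linarith) hβ1
  obtain ⟨k, hk | hk⟩ := Real.sin_eq_sin_iff.1 (hsα.trans hsin)
  -- If `α = π/2` the two families of equilibria coincide. Otherwise `y` would vanish at the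
  -- potential minimum `α`, and it would have to climb the potential to its right with no kinetic
  -- energy.
  · rcases (Real.arcsin_le_pi_div_two β).eq_or_lt with hα2 | hα2
    · exact ⟨k, by rw [hk]; linarith⟩
    · exfalso
      have hyα : y α = 0 := by
        have := h.periodic.int_mul k α
        rw [← hx, hk, ← this]
        congr 1; ring
      have hmono : StrictMonoOn (pendulumPotential β) (Set.Icc α (Real.pi / 2)) := by
        refine strictMonoOn_of_deriv_pos (convex_Icc _ _)
          (continuous_pendulumPotential β).continuousOn fun t ht => ?_
        rw [interior_Icc] at ht
        rw [(hasDerivAt_pendulumPotential β t).deriv]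
        have := Real.strictMonoOn_sin
          ⟨Real.neg_pi_div_two_le_arcsin β, Real.arcsin_le_pi_div_two β⟩
          ⟨by linarith [Real.neg_pi_div_two_le_arcsin β, ht.1], ht.2.le⟩ ht.1
        linarith
      have h1 := hmono ⟨le_rfl, hα2.le⟩ ⟨hα2.le, le_rfl⟩ hα2
      have h2 := h.antitone_energy hγ hα2.le
      simp only at h2
      rw [hyα] at h2
      nlinarith [sq_nonneg (y (Real.pi / 2))]
  · exact ⟨k, by rw [hk]; ring⟩

theorem criticalDrive_pos {γ : ℝ} (hγ : 0 < γ) : 0 < criticalDrive γ :=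
  let ⟨_, hy, _⟩ := exists_critical_graph hγ
  hy.drive_pos hγ

theorem criticalDrive_le_one {γ : ℝ} (hγ : 0 < γ) : criticalDrive γ ≤ 1 :=
  let ⟨_, hy, _, _, hx⟩ := exists_critical_graph hγ
  (hy.eq_saddle hγ hx).1

/-! ### Orbits carried by a graph, and comparison with a graph -/

theorem IsNonnegGraph.exists_flow {γ β : ℝ} {y : ℝ → ℝ} (h : IsNonnegGraph γ β y) {K : NNReal}
    (hLip : LipschitzWith K y) (x₀ : ℝ) :
    ∃ φ : ℝ → ℝ, φ 0 = x₀ ∧ ∀ t, HasDerivAt φ (y (φ t)) t := by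
  obtain ⟨m, hm⟩ := h.periodic.exists_isMax Real.two_pi_pos h.continuous
  refine exists_global_solution (f := fun _ x => y x) (M := Real.toNNReal (y m))
    (fun _ => hLip) (fun _ => continuous_const) (fun _ x => ?_) x₀
  rw [Real.coe_toNNReal _ (h.nonneg m), abs_of_nonneg (h.nonneg x)]
  exact hm x

theorem IsNonnegGraph.isPendulumSolution {γ β : ℝ} {y φ : ℝ → ℝ} (h : IsNonnegGraph γ β y)
    (hφ : ∀ t, HasDerivAt φ (y (φ t)) t) (hpos : ∀ t, 0 < y (φ t)) :
    IsPendulumSolution γ β φ fun t => y (φ t) :=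
  ⟨hφ, fun t => ((h.hasDerivAt (hpos t)).comp t (hφ t)).congr_deriv (by
    have := hpos t
    field_simp)⟩

/-- The relative energy of a solution with respect to a graph, possibly of another drive. -/
theorem IsPendulumSolution.hasDerivAt_relEnergy {γ β β' : ℝ} {φ z y : ℝ → ℝ}
    (h : IsPendulumSolution γ β φ z) (hy : IsNonnegGraph γ β' y) (t : ℝ) :
    HasDerivAt (fun t => y (φ t) ^ 2 / 2 - z t ^ 2 / 2)
      (z t * (β' - β - γ * (y (φ t) - z t))) t := by
  have h1 := ((hy.deriv_sq (φ t)).comp t (h.deriv_phi t)).sub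
    (((h.deriv_z t).pow 2).div_const 2)
  refine h1.congr_deriv ?_
  simp
  ring

/-- Squaring yields a Lyapunov function in the upper half plane whichever side of the graph the
solution is on. -/
theorem IsPendulumSolution.hasDerivAt_relEnergy_sq {γ β : ℝ} {φ z y : ℝ → ℝ}
    (h : IsPendulumSolution γ β φ z) (hy : IsNonnegGraph γ β y) (t : ℝ) :
    HasDerivAt (fun t => (y (φ t) ^ 2 / 2 - z t ^ 2 / 2) ^ 2)
      (-(γ * z t * (y (φ t) + z t) * (y (φ t) - z t) ^ 2)) t := by
  refine ((h.hasDerivAt_relEnergy hy t).pow 2).congr_deriv ?_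
  simp
  ring

/-- By the mean value theorem `φ (t + 1) - φ t`, which tends to zero, is a value of `y ∘ φ` at a
time between `t` and `t + 1`. -/
theorem eq_zero_of_tendsto_flow {y φ : ℝ → ℝ} (hy : Continuous y)
    (hφ : ∀ t, HasDerivAt φ (y (φ t)) t) {L : ℝ}
    (h : Tendsto φ atTop (𝓝 L) ∨ Tendsto φ atBot (𝓝 L)) : y L = 0 := by
  have hmvt : ∀ t : ℝ, ∃ ξ ∈ Set.Ioo t (t + 1), y (φ ξ) = φ (t + 1) - φ t := by
    intro t
    obtain ⟨ξ, hξ, h1⟩ := exists_hasDerivAt_eq_slope φ (fun t => y (φ t)) (lt_add_one t)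
      (fun s _ => (hφ s).continuousAt.continuousWithinAt) fun s _ => hφ s
    exact ⟨ξ, hξ, by rw [h1, add_sub_cancel_left, div_one]⟩
  choose ξ hξ hval using hmvt
  have key : ∀ l : Filter ℝ, l.NeBot → Tendsto φ l (𝓝 L) → Tendsto (fun t => t + 1) l l →
      Tendsto ξ l l → y L = 0 := by
    intro l _ h0 h1 h2
    have h3 : Tendsto (fun t => y (φ (ξ t))) l (𝓝 (y L)) := (hy.tendsto L).comp (h0.comp h2)
    have h4 : Tendsto (fun t => φ (t + 1) - φ t) l (𝓝 (L - L)) := (h0.comp h1).sub h0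
    simp only [hval] at h3
    rw [tendsto_nhds_unique h3 h4, sub_self]
  rcases h with h | h
  · exact key atTop inferInstance h (tendsto_atTop_add_const_right _ _ tendsto_id)
      (tendsto_atTop_mono (fun t => (hξ t).1.le) tendsto_id)
  · exact key atBot inferInstance h (tendsto_atBot_add_const_right _ _ tendsto_id)
      (tendsto_atBot_mono (fun t => (hξ t).2.le)
        (tendsto_atBot_add_const_right _ _ tendsto_id))

/-! ### The saddle connection at the critical drive -/

section connection

variable {γ β : ℝ} {y : ℝ → ℝ}

theorem IsNonnegGraph.saddle_eq_zero (hγ : 0 < γ) (h : IsNonnegGraph γ β y) {x : ℝ}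
    (hx : y x = 0) : y (Real.pi - Real.arcsin β) = 0 ∧ y (-Real.pi - Real.arcsin β) = 0 := by
  obtain ⟨-, k, hk⟩ := h.eq_saddle hγ hx
  have h1 : y (Real.pi - Real.arcsin β) = 0 := by
    rw [← hx, hk]
    exact (h.periodic.int_mul k _).symm
  refine ⟨h1, ?_⟩
  rw [← h1, ← h.periodic (-Real.pi - Real.arcsin β)]
  congr 1; ring

theorem IsNonnegGraph.pos_between (hγ : 0 < γ) (h : IsNonnegGraph γ β y) {x : ℝ}
    (hx : x ∈ Set.Ioo (-Real.pi - Real.arcsin β) (Real.pi - Real.arcsin β)) : 0 < y x := by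
  refine lt_of_le_of_ne (h.nonneg x) fun h0 => ?_
  obtain ⟨-, k, hk⟩ := h.eq_saddle hγ h0.symm
  have h1 : (k : ℝ) < 0 := by nlinarith [hx.2, Real.two_pi_pos]
  have h2 : (-1 : ℝ) < k := by nlinarith [hx.1, Real.two_pi_pos]
  have h3 : k < 0 := by exact_mod_cast h1
  have h4 : -1 < k := by exact_mod_cast h2
  omega

/-- The flow `φ' = y(φ)` is monotone and, by uniqueness, cannot reach a zero of `y`. Started between
two consecutive zeros, it converges to them at the two ends of time. -/
theorem IsNonnegGraph.exists_connection (hγ : 0 < γ) (h : IsNonnegGraph γ β y) {K : NNReal}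
    (hLip : LipschitzWith K y) {x : ℝ} (hx : y x = 0) :
    ∃ φ : ℝ → ℝ, (∀ t, φ t ∈ Set.Ioo (-Real.pi - Real.arcsin β) (Real.pi - Real.arcsin β)) ∧
      IsPendulumSolution γ β φ (fun t => y (φ t)) ∧
      Tendsto (fun t => (φ t, y (φ t))) atBot (𝓝 (saddleA0 β)) ∧
      Tendsto (fun t => (φ t, y (φ t))) atTop (𝓝 (saddleA1 β)) := by
  obtain ⟨hs₁, hs₀⟩ := h.saddle_eq_zero hγ hx
  set s₀ := -Real.pi - Real.arcsin β with hs₀'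
  set s₁ := Real.pi - Real.arcsin β with hs₁'
  have hα0 : 0 < Real.arcsin β := Real.arcsin_pos.2 (h.drive_pos hγ)
  have hα1 := Real.arcsin_le_pi_div_two β
  have hπ := Real.pi_pos
  obtain ⟨φ, hφ0, hφ⟩ := h.exists_flow hLip 0
  have hφc : Continuous φ := continuous_iff_continuousAt.2 fun t => (hφ t).continuousAt
  have hne : ∀ s, y s = 0 → s ≠ 0 → ∀ t, φ t ≠ s := by
    intro s hs hs0 t ht
    have := solution_unique (f := fun _ x => y x) (fun _ => hLip) hφ (y := fun _ => s)
      (fun t => by simpa only [hs] using hasDerivAt_const t s) (t₀ := t) ht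
    exact hs0 (by rw [← hφ0, this])
  have hmem : ∀ t, φ t ∈ Set.Ioo s₀ s₁ := by
    intro t
    constructor
    · by_contra! hcon
      obtain ⟨r, hr⟩ := mem_range_of_exists_le_of_exists_ge hφc ⟨t, hcon⟩
        ⟨0, by rw [hφ0]; linarith⟩
      exact hne s₀ hs₀ (by linarith) r hr
    · by_contra! hcon
      obtain ⟨r, hr⟩ := mem_range_of_exists_le_of_exists_ge hφc
        ⟨0, show φ 0 ≤ s₁ by rw [hφ0]; linarith⟩ ⟨t, hcon⟩
      exact hne s₁ hs₁ (by linarith) r hr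
  have hmono : Monotone φ := monotone_of_hasDerivAt_nonneg hφ fun t => h.nonneg _
  have htop : Tendsto φ atTop (𝓝 s₁) := by
    have h1 := tendsto_atTop_ciSup hmono ⟨s₁, by rintro _ ⟨t, rfl⟩; exact (hmem t).2.le⟩
    have h2 := eq_zero_of_tendsto_flow h.continuous hφ (Or.inl h1)
    have h3 : ⨆ t, φ t ≤ s₁ := le_of_tendsto' h1 fun t => (hmem t).2.le
    have h4 : s₀ < ⨆ t, φ t := (hmem 0).1.trans_le (hmono.ge_of_tendsto h1 0)
    rcases h3.eq_or_lt with h5 | h5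
    · rwa [h5] at h1
    · exact absurd h2 (h.pos_between hγ ⟨h4, h5⟩).ne'
  have hbot : Tendsto φ atBot (𝓝 s₀) := by
    have h1 := tendsto_atBot_ciInf hmono ⟨s₀, by rintro _ ⟨t, rfl⟩; exact (hmem t).1.le⟩
    have h2 := eq_zero_of_tendsto_flow h.continuous hφ (Or.inr h1)
    have h3 : s₀ ≤ ⨅ t, φ t := ge_of_tendsto' h1 fun t => (hmem t).1.le
    have h4 : ⨅ t, φ t < s₁ := (hmono.le_of_tendsto h1 0).trans_lt (hmem 0).2
    rcases h3.eq_or_lt with h5 | h5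
    · rwa [← h5] at h1
    · exact absurd h2 (h.pos_between hγ ⟨h5, h4⟩).ne'
  refine ⟨φ, hmem, h.isPendulumSolution hφ fun t => h.pos_between hγ (hmem t), ?_, ?_⟩
  · have := (h.continuous.tendsto s₀).comp hbot
    rw [hs₀] at this
    exact hbot.prodMk_nhds this
  · have := (h.continuous.tendsto s₁).comp htop
    rw [hs₁] at this
    exact htop.prodMk_nhds this

/-- A departing trajectory starts along a nonnegative graph through the saddles. -/
theorem IsDepartingTrajectory.eventually_eq_graph {φ z : ℝ → ℝ} (hγ : 0 < γ)
    (h : IsDepartingTrajectory γ β φ z) (hy : IsNonnegGraph γ β y)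
    (hs : y (-Real.pi - Real.arcsin β) = 0) : ∀ᶠ t in atBot, z t = y (φ t) := by
  obtain ⟨t₀, ht₀⟩ := eventually_atBot.1 h.upper
  have hanti : AntitoneOn (fun t => (y (φ t) ^ 2 / 2 - z t ^ 2 / 2) ^ 2) (Set.Iic t₀) :=
    antitoneOn_of_hasDerivAt_nonpos (convex_Iic t₀) (h.sol.hasDerivAt_relEnergy_sq hy)
      fun t ht => by
        rw [interior_Iic] at ht
        have h1 := ht₀ t (le_of_lt ht)
        have h2 := hy.nonneg (φ t)
        have : 0 ≤ γ * z t * (y (φ t) + z t) * (y (φ t) - z t) ^ 2 := by positivity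
        linarith
  -- A nonincreasing nonnegative function that starts from the limit zero at `-∞` vanishes.
  have hlim : Tendsto (fun t => (y (φ t) ^ 2 / 2 - z t ^ 2 / 2) ^ 2) atBot (𝓝 0) := by
    have h1 := (hy.continuous.tendsto _).comp h.tendsto_phi
    rw [hs] at h1
    simpa using (((h1.pow 2).div_const 2).sub ((h.tendsto_z.pow 2).div_const 2)).pow 2
  filter_upwards [eventually_le_atBot t₀] with t ht
  have h1 : (y (φ t) ^ 2 / 2 - z t ^ 2 / 2) ^ 2 ≤ 0 := by
    refine ge_of_tendsto hlim ?_
    filter_upwards [eventually_le_atBot t] with s hs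
    exact hanti (hs.trans ht) ht hs
  have h2 : y (φ t) ^ 2 / 2 - z t ^ 2 / 2 = 0 := pow_eq_zero_iff two_ne_zero |>.1
    (le_antisymm h1 (sq_nonneg _))
  exact (sq_eq_sq₀ (ht₀ t ht).le (hy.nonneg _)).1 (by linarith)

/-- If there is a saddle connection in the upper half plane, every departing trajectory runs along
it. -/
theorem IsDepartingTrajectory.runs_into_saddle {φ z : ℝ → ℝ} (hγ : 0 < γ)
    (h : IsDepartingTrajectory γ β φ z) (hy : IsNonnegGraph γ β y) {K : NNReal}
    (hLip : LipschitzWith K y) {x : ℝ} (hx : y x = 0) :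
    (∀ t, 0 < z t) ∧ Tendsto (fun t => (φ t, z t)) atTop (𝓝 (saddleA1 β)) := by
  obtain ⟨φ', hmem, hsol, hbot, htop⟩ := hy.exists_connection hγ hLip hx
  have hφbot : Tendsto φ' atBot (𝓝 (-Real.pi - Real.arcsin β)) :=
    (continuous_fst.tendsto _).comp hbot
  obtain ⟨a, ha⟩ := eventually_atBot.1 h.upper
  obtain ⟨t₀, hta, heq, hlt⟩ := ((eventually_le_atBot a).and ((h.eventually_eq_graph hγ hy
    (hy.saddle_eq_zero hγ hx).2).and
    (h.tendsto_phi.eventually_lt_const (hmem 0).1))).exists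
  have hgt : -Real.pi - Real.arcsin β < φ t₀ := by
    have hmono : StrictMonoOn φ (Set.Iic a) :=
      strictMonoOn_of_deriv_pos (convex_Iic _) h.sol.continuous_phi.continuousOn fun t ht => by
        rw [interior_Iic] at ht
        rw [(h.sol.deriv_phi t).deriv]
        exact ha t (le_of_lt ht)
    have hlt' : t₀ - 1 < t₀ := sub_one_lt t₀
    refine lt_of_le_of_lt ?_ (hmono (hlt'.le.trans hta) hta hlt')
    refine le_of_tendsto h.tendsto_phi ?_
    filter_upwards [eventually_le_atBot (t₀ - 1)] with s hs
    exact hmono.monotoneOn (hs.trans (hlt'.le.trans hta)) (hlt'.le.trans hta) hs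
  -- The connection passes through the abscissa `φ t₀` too. Both trajectories lie on the graph
  -- there, so they are time shifts of each other.
  obtain ⟨r, hr⟩ := (hφbot.eventually_lt_const hgt).exists
  obtain ⟨t₁, ht₁⟩ := mem_range_of_exists_le_of_exists_ge hsol.continuous_phi ⟨r, hr.le⟩
    ⟨0, hlt.le⟩
  have hadd : t₀ + (t₁ - t₀) = t₁ := by ring
  obtain ⟨h1, h2⟩ := h.sol.unique (hsol.shift (t₁ - t₀)) (t₀ := t₀)
    (by simp only [hadd, ht₁]) (by simp only [hadd, ht₁, heq])
  rw [h1, h2]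
  exact ⟨fun t => hy.pos_between hγ (hmem _),
    htop.comp (tendsto_atTop_add_const_right _ (t₁ - t₀) tendsto_id)⟩

end connection

/-! ### Uniqueness of the critical drive -/

section comparison

variable {γ β β' : ℝ} {φ z y : ℝ → ℝ}

/-- There is no trajectory from `A₀` to `A₁` below a positive periodic orbit. -/
theorem IsDepartingTrajectory.not_tendsto_of_graph (hγ : 0 < γ)
    (h : IsDepartingTrajectory γ β φ z) (hz : ∀ t, 0 < z t) (hy : IsNonnegGraph γ β y)
    (hpos : ∀ x, 0 < y x) : ¬ Tendsto (fun t => (φ t, z t)) atTop (𝓝 (saddleA1 β)) := by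
  intro hlim
  have hφ : Tendsto φ atTop (𝓝 (Real.pi - Real.arcsin β)) := (continuous_fst.tendsto _).comp hlim
  have hz' : Tendsto z atTop (𝓝 0) := (continuous_snd.tendsto _).comp hlim
  set e := fun t => (y (φ t) ^ 2 / 2 - z t ^ 2 / 2) ^ 2 with he
  have hs : y (-Real.pi - Real.arcsin β) = y (Real.pi - Real.arcsin β) := by
    rw [← hy.periodic (-Real.pi - Real.arcsin β)]
    congr 1; ring
  set c := y (Real.pi - Real.arcsin β) with hc
  have hbot : Tendsto e atBot (𝓝 ((c ^ 2 / 2 - 0 ^ 2 / 2) ^ 2)) := by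
    have h1 := (hy.continuous.tendsto _).comp h.tendsto_phi
    rw [hs] at h1
    exact (((h1.pow 2).div_const 2).sub ((h.tendsto_z.pow 2).div_const 2)).pow 2
  have htop : Tendsto e atTop (𝓝 ((c ^ 2 / 2 - 0 ^ 2 / 2) ^ 2)) :=
    (((((hy.continuous.tendsto _).comp hφ).pow 2).div_const 2).sub
      ((hz'.pow 2).div_const 2)).pow 2
  have hd := h.sol.hasDerivAt_relEnergy_sq hy
  have hanti : Antitone e := antitone_of_hasDerivAt_nonpos hd fun t => by
    have h1 := hz t
    have h2 := hpos (φ t)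
    have : 0 ≤ γ * z t * (y (φ t) + z t) * (y (φ t) - z t) ^ 2 := by positivity
    simpa using this
  -- By periodicity of `y` the limits at both saddles are equal, so `e` is constant. Zero derivative
  -- forces `y = z`, so the constant is zero, whereas the limit is positive.
  obtain ⟨h1, h2⟩ := deriv_eq_zero_of_antitone_of_tendsto hd hanti hbot htop 0
  have h3 : 0 < γ * z 0 * (y (φ 0) + z 0) := by
    have h1 := hz 0
    have h2 := hpos (φ 0)
    positivity
  have h4 : (y (φ 0) - z 0) ^ 2 = 0 := by
    rcases mul_eq_zero.1 (neg_eq_zero.1 h2) with h5 | h5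
    · exact absurd h5 h3.ne'
    · exact h5
  have h5 : y (φ 0) = z 0 := sub_eq_zero.1 (pow_eq_zero_iff two_ne_zero |>.1 h4)
  have h6 : 0 < c := hpos _
  have h7 : 0 < (c ^ 2 / 2 - 0 ^ 2 / 2) ^ 2 := by
    have : c ^ 2 / 2 - 0 ^ 2 / 2 = c ^ 2 / 2 := by ring
    rw [this]; positivity
  rw [← h1] at h7
  simp [h5] at h7

/-- A graph of larger drive stays above a solution where the relative energy is minimal. -/
theorem IsPendulumSolution.relEnergy_pos (hγ : 0 < γ) (h : IsPendulumSolution γ β φ z)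
    (hz : ∀ t, 0 < z t) (hy : IsNonnegGraph γ β' y) (hβ : β < β') {m : ℝ}
    (hm : ∀ t, y (φ m) ^ 2 / 2 - z m ^ 2 / 2 ≤ y (φ t) ^ 2 / 2 - z t ^ 2 / 2) (t : ℝ) :
    z t < y (φ t) := by
  have h0 := deriv_eq_zero_of_forall_le hm (h.hasDerivAt_relEnergy hy m)
  have h1 : β' - β - γ * (y (φ m) - z m) = 0 := by
    rcases mul_eq_zero.1 h0 with h2 | h2
    · exact absurd h2 (hz m).ne'
    · exact h2
  have h2 : z m < y (φ m) := lt_of_mul_lt_mul_left (by linarith) hγ.le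
  have h3 := pow_lt_pow_left₀ h2 (hz m).le two_ne_zero
  exact lt_of_pow_lt_pow_left₀ 2 (hy.nonneg _) (by linarith [hm t])

/-- If `β < β'`, then `π - arcsin β'` lies strictly between the ends of the connection for `β`.
There the relative energy is negative, while its limits at both ends are nonnegative. So it has a
minimum, and comparison at the minimum puts the connection below the graph even at the zero of `y`.
-/
theorem IsCriticalDrive.ge_of_graph_zero (hγ : 0 < γ) (h : IsCriticalDrive γ β)
    (hy : IsNonnegGraph γ β' y) {x : ℝ} (hx : y x = 0) : β' ≤ β := by
  obtain ⟨hβ0, hβ1, φ, z, hdep, hlim⟩ := h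
  by_contra! hβ
  have hz := hdep.pos_of_tendsto hγ hβ0 hβ1 hlim
  have hφ : Tendsto φ atTop (𝓝 (Real.pi - Real.arcsin β)) := (continuous_fst.tendsto _).comp hlim
  have hz' : Tendsto z atTop (𝓝 0) := (continuous_snd.tendsto _).comp hlim
  have hs := (hy.saddle_eq_zero hγ hx).1
  have hβ'1 := (hy.eq_saddle hγ hx).1
  have harc : Real.arcsin β < Real.arcsin β' :=
    Real.strictMonoOn_arcsin ⟨by linarith, hβ1⟩ ⟨by linarith, hβ'1⟩ hβ
  have h1 : -Real.pi - Real.arcsin β < Real.pi - Real.arcsin β' := by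
    linarith [Real.arcsin_nonneg.2 hβ0, Real.arcsin_le_pi_div_two β', Real.pi_pos]
  obtain ⟨r₁, hr₁⟩ := (hdep.tendsto_phi.eventually_lt_const h1).exists
  obtain ⟨r₂, hr₂⟩ := (hφ.eventually_const_lt
    (show Real.pi - Real.arcsin β' < Real.pi - Real.arcsin β by linarith)).exists
  obtain ⟨t₀, ht₀⟩ := mem_range_of_exists_le_of_exists_ge hdep.sol.continuous_phi
    ⟨r₁, hr₁.le⟩ ⟨r₂, hr₂.le⟩
  have hneg : y (φ t₀) ^ 2 / 2 - z t₀ ^ 2 / 2 < 0 := by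
    rw [ht₀, hs]
    nlinarith [pow_pos (hz t₀) 2]
  have hL : ∀ c : ℝ, y (φ t₀) ^ 2 / 2 - z t₀ ^ 2 / 2 < c ^ 2 / 2 - 0 ^ 2 / 2 := fun c => by
    nlinarith [sq_nonneg c]
  obtain ⟨m, hm⟩ := exists_isMin_of_tendsto (f := fun t => y (φ t) ^ 2 / 2 - z t ^ 2 / 2)
    (continuous_iff_continuousAt.2 fun t => (hdep.sol.hasDerivAt_relEnergy hy t).continuousAt)
    (((((hy.continuous.tendsto _).comp hdep.tendsto_phi).pow 2).div_const 2).sub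
      ((hdep.tendsto_z.pow 2).div_const 2))
    (((((hy.continuous.tendsto _).comp hφ).pow 2).div_const 2).sub ((hz'.pow 2).div_const 2))
    (hL _) (hL _)
  have h2 := hdep.sol.relEnergy_pos hγ hz hy hβ hm t₀
  rw [ht₀, hs] at h2
  exact lt_asymm h2 (hz t₀)

theorem IsCriticalDrive.eq_criticalDrive (hγ : 0 < γ) (h : IsCriticalDrive γ β) :
    β = criticalDrive γ := by
  obtain ⟨y, hy, -, x, hx⟩ := exists_critical_graph hγ
  refine le_antisymm ?_ (h.ge_of_graph_zero hγ hy hx)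
  by_contra! hlt
  obtain ⟨w, hw, hpos⟩ := (mem_runningDrives_iff hγ).2 hlt
  obtain ⟨hβ0, hβ1, φ, z, hdep, hlim⟩ := h
  exact hdep.not_tendsto_of_graph hγ (hdep.pos_of_tendsto hγ hβ0 hβ1 hlim) hw hpos hlim

/-- There is no cycle if a graph for some larger drive has a zero. -/
theorem IsCylinderCycle.drive_le (hγ : 0 < γ) (hβ : 0 ≤ β) {n : ℤ}
    (h : IsCylinderCycle γ β n φ z) (hy : IsNonnegGraph γ β' y) {x : ℝ} (hx : y x = 0) :
    β' ≤ β := by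
  by_contra! hlt
  obtain ⟨T, hT, hper⟩ := h.periodic
  obtain ⟨m, hm⟩ := Function.Periodic.exists_isMin hT
    (f := fun t => y (φ t) ^ 2 / 2 - z t ^ 2 / 2) (fun t => by
      have := hy.periodic.int_mul n (φ t)
      simp only [(hper t).1, (hper t).2, mul_comm (2 * Real.pi), this])
    (continuous_iff_continuousAt.2 fun t => (h.sol.hasDerivAt_relEnergy hy t).continuousAt)
  obtain ⟨t₀, ht₀⟩ := h.exists_phi_eq hγ hβ x
  have h2 := h.sol.relEnergy_pos hγ (h.pos hγ hβ) hy hlt hm t₀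
  rw [ht₀, hx] at h2
  exact lt_asymm h2 (h.pos hγ hβ t₀)

/-- Every cycle lies on the graph of the periodic orbit of the same drive. -/
theorem IsCylinderCycle.eq_graph (hγ : 0 < γ) (hβ : 0 ≤ β) {n : ℤ}
    (h : IsCylinderCycle γ β n φ z) (hy : IsNonnegGraph γ β y) (t : ℝ) : z t = y (φ t) := by
  obtain ⟨T, hT, hper⟩ := h.periodic
  have hz := h.pos hγ hβ
  set e := fun t => (y (φ t) ^ 2 / 2 - z t ^ 2 / 2) ^ 2 with he
  have hd := h.sol.hasDerivAt_relEnergy_sq hy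
  have hanti : Antitone e := antitone_of_hasDerivAt_nonpos hd fun t => by
    have h1 := hz t
    have h2 := hy.nonneg (φ t)
    have : 0 ≤ γ * z t * (y (φ t) + z t) * (y (φ t) - z t) ^ 2 := by positivity
    simpa using this
  have hep : Function.Periodic e T := fun t => by
    have := hy.periodic.int_mul n (φ t)
    simp only [he, (hper t).1, (hper t).2, mul_comm (2 * Real.pi), this]
  -- The value `e s` recurs after `t`, and `e` does not increase. So `e` is maximal at every `t` and
  -- its derivative vanishes.
  have hmax : ∀ s, e s ≤ e t := by
    intro s
    obtain ⟨k, hk⟩ := exists_nat_gt ((t - s) / T)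
    rw [div_lt_iff₀ hT] at hk
    have h1 := hep.nat_mul k s
    rw [← h1]
    exact hanti (by linarith)
  have h0 := deriv_eq_zero_of_forall_ge hmax (hd t)
  have h3 : 0 < γ * z t * (y (φ t) + z t) := by
    have h1 := hz t
    have h2 := hy.nonneg (φ t)
    positivity
  rcases mul_eq_zero.1 (neg_eq_zero.1 h0) with h5 | h5
  · exact absurd h5 h3.ne'
  · linarith [pow_eq_zero_iff two_ne_zero |>.1 h5]

end comparison

/-! ### The periodic orbit as a stable limit cycle -/

section stability

variable {γ β : ℝ} {y φ z : ℝ → ℝ}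

/-- The periodic orbit is traversed by a cycle with winding number `1`. -/
theorem IsNonnegGraph.exists_cycle (h : IsNonnegGraph γ β y) {K : NNReal}
    (hLip : LipschitzWith K y) (hpos : ∀ x, 0 < y x) :
    ∃ φ z : ℝ → ℝ, IsCylinderCycle γ β 1 φ z ∧ ∀ t, z t = y (φ t) := by
  obtain ⟨xm, hxm⟩ := h.periodic.exists_isMin Real.two_pi_pos h.continuous
  obtain ⟨φ, hφ0, hφ⟩ := h.exists_flow hLip 0
  have hsol := h.isPendulumSolution hφ fun t => hpos _
  refine ⟨φ, fun t => y (φ t), ⟨hsol, ?_, ?_⟩, fun t => rfl⟩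
  · rintro ⟨a, b, hab⟩
    have h1 : φ = fun _ => a := funext fun t => (hab t).1
    have h2 := (hφ 0).unique (h1 ▸ hasDerivAt_const (0 : ℝ) a)
    exact (hpos _).ne' h2
  · have hgrow : ∀ t, 0 ≤ t → y xm * t ≤ φ t := by
      intro t ht
      have hd : ∀ t, HasDerivAt (fun t => φ t - y xm * t) (y (φ t) - y xm) t := fun t =>
        ((hφ t).sub ((hasDerivAt_id t).const_mul (y xm))).congr_deriv (by simp)
      have := monotone_of_hasDerivAt_nonneg hd (fun t => sub_nonneg.2 (hxm _)) ht
      simp only [hφ0, mul_zero, sub_zero] at this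
      linarith
    have hT0 : 0 < 2 * Real.pi / y xm := div_pos Real.two_pi_pos (hpos xm)
    have hT1 : 2 * Real.pi ≤ φ (2 * Real.pi / y xm) := by
      have := hgrow _ hT0.le
      rwa [mul_div_cancel₀ _ (hpos xm).ne'] at this
    obtain ⟨T, hT, hφT⟩ := intermediate_value_Icc hT0.le hsol.continuous_phi.continuousOn
      (show 2 * Real.pi ∈ Set.Icc (φ 0) (φ (2 * Real.pi / y xm)) from
        ⟨by rw [hφ0]; exact Real.two_pi_pos.le, hT1⟩)
    have hTne : T ≠ 0 := by
      rintro rfl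
      rw [hφ0] at hφT
      exact Real.two_pi_pos.ne hφT
    -- Both sides solve `φ' = y(φ)`, by periodicity of `y`, and both equal `2π` at time zero.
    have hshift : (fun t => φ (t + T)) = fun t => φ t + 2 * Real.pi :=
      solution_unique (f := fun _ x => y x) (fun _ => hLip) (t₀ := 0)
        (fun t => (hφ (t + T)).comp_add_const t T)
        (fun t => ((hφ t).add_const (2 * Real.pi)).congr_deriv (h.periodic _).symm)
        (by simp only [zero_add, hφT, hφ0])
    refine ⟨T, lt_of_le_of_ne hT.1 hTne.symm, fun t => ?_⟩
    have ht : φ (t + T) = φ t + 2 * Real.pi := congrFun hshift t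
    exact ⟨by rw [ht]; simp, by rw [ht, h.periodic]⟩

/-- A solution of small relative energy starting above the axis stays above the axis. -/
theorem IsPendulumSolution.pos_of_relEnergy_small (hγ : 0 < γ)
    (h : IsPendulumSolution γ β φ z) (hy : IsNonnegGraph γ β y) {m : ℝ} (hm : 0 < m)
    (hmy : ∀ x, m ≤ y x) (h0 : 0 < z 0)
    (hE : (y (φ 0) ^ 2 / 2 - z 0 ^ 2 / 2) ^ 2 ≤ (m ^ 2 / 4) ^ 2) {t : ℝ} (ht : 0 ≤ t) :
    0 < z t := by
  by_contra! hneg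
  set S : Set ℝ := {t | 0 ≤ t ∧ z t ≤ 0} with hS
  have hSc : IsClosed S := (isClosed_le continuous_const continuous_id).inter
    (isClosed_le h.continuous_z continuous_const)
  have hSb : BddBelow S := ⟨0, fun _ hs => hs.1⟩
  have hmem : sInf S ∈ S := hSc.csInf_mem ⟨t, ht, hneg⟩ hSb
  set s := sInf S with hs
  obtain ⟨r, hr, hzr⟩ := intermediate_value_Icc' hmem.1 h.continuous_z.continuousOn
    (show (0 : ℝ) ∈ Set.Icc (z s) (z 0) from ⟨hmem.2, h0.le⟩)
  have hrs : r = s := le_antisymm hr.2 (csInf_le hSb ⟨hr.1, hzr.le⟩)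
  rw [hrs] at hzr
  have hanti : AntitoneOn (fun t => (y (φ t) ^ 2 / 2 - z t ^ 2 / 2) ^ 2) (Set.Icc 0 s) :=
    antitoneOn_of_hasDerivAt_nonpos (convex_Icc 0 s) (h.hasDerivAt_relEnergy_sq hy)
      fun q hq => by
        rw [interior_Icc] at hq
        have h1 : 0 < z q := by
          by_contra! hcon
          exact absurd (csInf_le hSb ⟨hq.1.le, hcon⟩) (not_le.2 hq.2)
        have h2 := hy.nonneg (φ q)
        have : 0 ≤ γ * z q * (y (φ q) + z q) * (y (φ q) - z q) ^ 2 := by positivity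
        linarith
  have h1 := (hanti ⟨le_rfl, hmem.1⟩ ⟨hmem.1, le_rfl⟩ hmem.1).trans hE
  simp only [hzr] at h1
  -- At the first zero `s` of `z` the relative energy is at least `m²/2`, yet up to then its
  -- absolute value has not grown beyond `m²/4`.
  have h2 : m ^ 2 / 2 ≤ y (φ s) ^ 2 / 2 - 0 ^ 2 / 2 := by
    have := pow_le_pow_left₀ hm.le (hmy (φ s)) 2
    linarith
  have h3 : m ^ 2 / 4 < m ^ 2 / 2 := by linarith [pow_pos hm 2]
  have h4 := pow_lt_pow_left₀ h3 (by positivity) two_ne_zero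
  have h5 := pow_le_pow_left₀ (by positivity) h2 2
  linarith

/-- Exponential convergence towards the periodic orbit. -/
theorem IsPendulumSolution.sq_sub_graph_le (hγ : 0 < γ)
    (h : IsPendulumSolution γ β φ z) (hy : IsNonnegGraph γ β y) {m M d : ℝ} (hm : 0 < m)
    (hmy : ∀ x, m ≤ y x) (hyM : ∀ x, y x ≤ M) (hd : d ≤ m ^ 2 / (6 * M))
    (h0 : |z 0 - y (φ 0)| ≤ d) {t : ℝ} (ht : 0 ≤ t) :
    (z t - y (φ t)) ^ 2 ≤ (3 * M * d / m) ^ 2 * Real.exp (-(2 * γ * m / (3 * M) * t)) := by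
  have hmM : m ≤ M := (hmy 0).trans (hyM 0)
  have hM : 0 < M := hm.trans_le hmM
  have hd0 : 0 ≤ d := (abs_nonneg _).trans h0
  have hd1 : d * (6 * M) ≤ m ^ 2 := (le_div_iff₀ (by positivity)).1 hd
  have hd2 : 6 * d ≤ m := by nlinarith
  obtain ⟨ha, hb⟩ := abs_le.1 h0
  have hy0 := hmy (φ 0)
  have hyM0 := hyM (φ 0)
  have hz0 : 0 < z 0 := by linarith
  -- Here `y + z ≤ 3M` at time zero. The bound on `d` makes `3Md/2 ≤ m²/4`, the threshold that keeps
  -- `z` positive.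
  have hE0 : (y (φ 0) ^ 2 / 2 - z 0 ^ 2 / 2) ^ 2 ≤ (3 * M * d / 2) ^ 2 := by
    rw [sq_le_sq, show y (φ 0) ^ 2 / 2 - z 0 ^ 2 / 2 =
      -((z 0 - y (φ 0)) * ((y (φ 0) + z 0) / 2)) by ring, abs_neg, abs_mul,
      abs_of_pos (show 0 < (y (φ 0) + z 0) / 2 by linarith),
      abs_of_nonneg (show 0 ≤ 3 * M * d / 2 by positivity)]
    calc _ ≤ d * (3 * M / 2) := by
          refine mul_le_mul h0 (by linarith) (by linarith) hd0
      _ = _ := by ring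
  have hE1 : (3 * M * d / 2) ^ 2 ≤ (m ^ 2 / 4) ^ 2 :=
    pow_le_pow_left₀ (by positivity) (by linarith) 2
  have hpos : ∀ s, 0 ≤ s → 0 < z s := fun s hs =>
    h.pos_of_relEnergy_small hγ hy hm hmy hz0 (hE0.trans hE1) hs
  have hanti : AntitoneOn (fun t => (y (φ t) ^ 2 / 2 - z t ^ 2 / 2) ^ 2) (Set.Ici 0) :=
    antitoneOn_of_hasDerivAt_nonpos (convex_Ici 0) (h.hasDerivAt_relEnergy_sq hy)
      fun q hq => by
        rw [interior_Ici] at hq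
        have h1 := hpos q (le_of_lt hq)
        have h2 := hy.nonneg (φ q)
        have : 0 ≤ γ * z q * (y (φ q) + z q) * (y (φ q) - z q) ^ 2 := by positivity
        linarith
  have hbd : ∀ s, 0 ≤ s → m / 2 ≤ z s ∧ z s ≤ 2 * M := by
    intro s hs
    have h1 := ((hanti (Set.mem_Ici.2 le_rfl) hs hs).trans hE0).trans hE1
    obtain ⟨h2, h3⟩ := abs_le.1 (abs_le_of_sq_le_sq h1 (by positivity))
    have h4 := pow_le_pow_left₀ hm.le (hmy (φ s)) 2
    have h5 := pow_le_pow_left₀ (hy.nonneg (φ s)) (hyM (φ s)) 2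
    have h6 := pow_le_pow_left₀ hm.le hmM 2
    exact ⟨le_of_sq_le_sq (by nlinarith) (hpos s hs).le,
      le_of_sq_le_sq (by nlinarith) (by positivity)⟩
  -- The logarithmic decay rate of `e²` is `4γz/(y + z)`. With `z ≥ m/2` and `y + z ≤ 3M` it is at
  -- least `k`.
  set k := 2 * γ * m / (3 * M) with hk
  have hkM : k * (3 * M) = 2 * γ * m := div_mul_cancel₀ _ (by positivity)
  have hk0 : 0 < k := by positivity
  have hG : ∀ s, HasDerivAt
      (fun s => (y (φ s) ^ 2 / 2 - z s ^ 2 / 2) ^ 2 * Real.exp (k * s))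
      ((-(γ * z s * (y (φ s) + z s) * (y (φ s) - z s) ^ 2)) * Real.exp (k * s) +
        (y (φ s) ^ 2 / 2 - z s ^ 2 / 2) ^ 2 * (Real.exp (k * s) * k)) s := fun s =>
    (h.hasDerivAt_relEnergy_sq hy s).mul
      (((hasDerivAt_id s).const_mul k).exp.congr_deriv (by simp))
  have hGanti : AntitoneOn
      (fun s => (y (φ s) ^ 2 / 2 - z s ^ 2 / 2) ^ 2 * Real.exp (k * s)) (Set.Ici 0) :=
    antitoneOn_of_hasDerivAt_nonpos (convex_Ici 0) hG fun s hs => by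
      rw [interior_Ici] at hs
      obtain ⟨h1, h2⟩ := hbd s (le_of_lt hs)
      have h3 := hy.nonneg (φ s)
      have h4 : k * (y (φ s) + z s) ≤ 4 * (γ * z s) := by
        have h5 : k * (y (φ s) + z s) ≤ k * (3 * M) :=
          mul_le_mul_of_nonneg_left (by linarith [hyM (φ s)]) hk0.le
        nlinarith
      have h5 : 0 ≤ (y (φ s) + z s) * (y (φ s) - z s) ^ 2 * Real.exp (k * s) := by
        have := hpos s (le_of_lt hs)
        positivity
      have h6 := mul_le_mul_of_nonneg_right h4 h5
      linear_combination h6 / 4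
  have h1 := hGanti (Set.mem_Ici.2 le_rfl) ht ht
  simp only [mul_zero, Real.exp_zero, mul_one] at h1
  have h2 : (y (φ t) ^ 2 / 2 - z t ^ 2 / 2) ^ 2 ≤ (3 * M * d / 2) ^ 2 * Real.exp (-(k * t)) := by
    rw [Real.exp_neg, ← div_eq_mul_inv, le_div_iff₀ (Real.exp_pos _)]
    exact h1.trans hE0
  have h3 : (z t - y (φ t)) ^ 2 * (m / 2) ^ 2 ≤ (y (φ t) ^ 2 / 2 - z t ^ 2 / 2) ^ 2 := by
    have h4 : m / 2 ≤ (y (φ t) + z t) / 2 := by linarith [hmy (φ t), hpos t ht]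
    have h5 := mul_le_mul_of_nonneg_left (pow_le_pow_left₀ (by positivity) h4 2)
      (sq_nonneg (z t - y (φ t)))
    calc _ ≤ _ := h5
      _ = _ := by ring
  have h4 : (z t - y (φ t)) ^ 2 ≤ (3 * M * d / 2) ^ 2 * Real.exp (-(k * t)) / (m / 2) ^ 2 :=
    (le_div_iff₀ (by positivity)).2 (h3.trans h2)
  refine h4.trans (le_of_eq ?_)
  field_simp

theorem infDist_graphCurve_le (y : ℝ → ℝ) (a b : ℝ) :
    Metric.infDist (a, b) (graphCurve y) ≤ |b - y a| := by
  refine (Metric.infDist_le_dist_of_mem (show (a, y a) ∈ graphCurve y from rfl)).trans ?_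
  simp [Prod.dist_eq, Real.dist_eq]

/-- Together with `infDist_graphCurve_le`, this lets the vertical gap `|z - y(φ)|` stand in for the
distance to the curve. -/
theorem abs_sub_le_of_infDist_lt {K : NNReal} (hLip : LipschitzWith K y) {a b δ : ℝ}
    (h : Metric.infDist (a, b) (graphCurve y) < δ) : |b - y a| ≤ (1 + K) * δ := by
  obtain ⟨⟨p, q⟩, hpq, hdist⟩ :=
    (Metric.infDist_lt_iff ⟨((0 : ℝ), y 0), (rfl : y 0 = y 0)⟩).1 h
  have hq : q = y p := hpq
  subst hq
  rw [Prod.dist_eq, max_lt_iff] at hdist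
  have h1 := hLip.dist_le_mul p a
  have h2 : (K : ℝ) * dist p a ≤ K * δ := by
    rw [dist_comm]
    exact mul_le_mul_of_nonneg_left hdist.1.le K.2
  calc |b - y a| = dist b (y a) := (Real.dist_eq _ _).symm
    _ ≤ dist b (y p) + dist (y p) (y a) := dist_triangle _ _ _
    _ ≤ δ + K * δ := add_le_add hdist.2.le (h1.trans h2)
    _ = _ := by ring

theorem IsNonnegGraph.isStableLimitCycle (hγ : 0 < γ) (hy : IsNonnegGraph γ β y) {K : NNReal}
    (hLip : LipschitzWith K y) (hpos : ∀ x, 0 < y x) : IsStableLimitCycle γ β y := by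
  obtain ⟨xm, hxm⟩ := hy.periodic.exists_isMin Real.two_pi_pos hy.continuous
  obtain ⟨xM, hxM⟩ := hy.periodic.exists_isMax Real.two_pi_pos hy.continuous
  have hm : 0 < y xm := hpos xm
  have hM : 0 < y xM := hpos xM
  have hK : 0 < 1 + (K : ℝ) := by positivity
  have hclose : ∀ d, d ≤ y xm ^ 2 / (6 * y xM) → ∀ φ z : ℝ → ℝ, IsPendulumSolution γ β φ z →
      Metric.infDist (φ 0, z 0) (graphCurve y) < d / (1 + K) → ∀ t, 0 ≤ t →
      (z t - y (φ t)) ^ 2 ≤ (3 * y xM * d / y xm) ^ 2 *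
        Real.exp (-(2 * γ * y xm / (3 * y xM) * t)) := fun d hd φ z h hdist t ht => by
    have h0 := abs_sub_le_of_infDist_lt hLip hdist
    rw [mul_div_cancel₀ _ hK.ne'] at h0
    exact h.sq_sub_graph_le hγ hy hm hxm hxM hd h0 ht
  refine ⟨fun ε hε => ?_, ?_⟩
  -- The first entry makes the decay estimate applicable. The second makes its amplitude `3Md/m` at
  -- most `ε/2`.
  · set d := min (y xm ^ 2 / (6 * y xM)) (y xm * ε / (6 * y xM)) with hd
    have hd0 : 0 < d := lt_min (by positivity) (by positivity)
    refine ⟨d / (1 + K), by positivity, fun φ z h hdist t ht =>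
      (infDist_graphCurve_le y _ _).trans_lt ?_⟩
    have h1 := hclose d (min_le_left _ _) φ z h hdist t ht
    have h2 : Real.exp (-(2 * γ * y xm / (3 * y xM) * t)) ≤ 1 :=
      Real.exp_le_one_iff.2 (neg_nonpos.2 (by positivity))
    have h3 : (z t - y (φ t)) ^ 2 ≤ (3 * y xM * d / y xm) ^ 2 :=
      h1.trans (mul_le_of_le_one_right (sq_nonneg _) h2)
    refine (abs_le_of_sq_le_sq h3 (by positivity)).trans_lt ?_
    have h4 := (le_div_iff₀ (by positivity)).1 (min_le_right (y xm ^ 2 / (6 * y xM)) _ : d ≤ _)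
    rw [div_lt_iff₀ hm]
    nlinarith [mul_pos hm hε]
  · set d := y xm ^ 2 / (6 * y xM) with hd
    have hd0 : 0 < d := by positivity
    refine ⟨d / (1 + K), by positivity, fun φ z h hdist => ?_⟩
    have h1 := hclose d le_rfl φ z h hdist
    have hk : 0 < 2 * γ * y xm / (3 * y xM) := by positivity
    have h2 : Tendsto (fun t => √((3 * y xM * d / y xm) ^ 2 *
        Real.exp (-(2 * γ * y xm / (3 * y xM) * t)))) atTop (𝓝 0) := by
      have h3 := (Real.tendsto_exp_neg_atTop_nhds_zero.comp
        (tendsto_id.const_mul_atTop hk)).const_mul ((3 * y xM * d / y xm) ^ 2)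
      have h4 := (Real.continuous_sqrt.tendsto _).comp h3
      simpa [Function.comp_def] using h4
    refine tendsto_of_tendsto_of_tendsto_of_le_of_le' tendsto_const_nhds h2
      (Eventually.of_forall fun t => Metric.infDist_nonneg) ?_
    filter_upwards [eventually_ge_atTop 0] with t ht
    exact (infDist_graphCurve_le y _ _).trans (Real.abs_le_sqrt (h1 t ht))

end stability

theorem mainTheorem1 :
    ∃ β₀ : ℝ → ℝ, ∀ γ₁ : ℝ, 0 < γ₁ →
      -- (a) a critical drive exists, and the whole of `R(β₀)` runs above the axis into `A₁`
      ((0 < β₀ γ₁ ∧ β₀ γ₁ ≤ 1 ∧ IsCriticalDrive γ₁ (β₀ γ₁) ∧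
        ∀ φ z : ℝ → ℝ, IsDepartingTrajectory γ₁ (β₀ γ₁) φ z →
          (∀ t, 0 < z t) ∧ Tendsto (fun t => (φ t, z t)) atTop (𝓝 (saddleA1 (β₀ γ₁)))) ∧
      -- (b) it is unique
      (∀ β : ℝ, IsCriticalDrive γ₁ β → β = β₀ γ₁) ∧
      -- (c) above it there is a positive periodic solution, below it there is none
      ((∀ β : ℝ, β₀ γ₁ < β → ∃ zT : ℝ → ℝ, IsPeriodicGraph γ₁ β zT ∧ (∀ x, 0 < zT x) ∧
          ∃ φ z : ℝ → ℝ, IsCylinderCycle γ₁ β 1 φ z ∧ ∀ t, z t = zT (φ t)) ∧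
        (∀ β : ℝ, 0 ≤ β → β < β₀ γ₁ →
          (¬ ∃ z : ℝ → ℝ, IsPeriodicGraph γ₁ β z) ∧
          ¬ ∃ (n : ℤ) (φ z : ℝ → ℝ), IsCylinderCycle γ₁ β n φ z)) ∧
      -- (d) the periodic solution is unique and a stable limit cycle
      (∀ β : ℝ, 0 ≤ β → ∀ zT : ℝ → ℝ, IsPeriodicGraph γ₁ β zT →
        (∀ w : ℝ → ℝ, IsPeriodicGraph γ₁ β w → w = zT) ∧
        (∀ (n : ℤ) (φ z : ℝ → ℝ), IsCylinderCycle γ₁ β n φ z → ∀ t, z t = zT (φ t)) ∧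
        IsStableLimitCycle γ₁ β zT) ∧
      -- (e) once the critical drive equals `1`, it stays `1` for larger friction
      (β₀ γ₁ = 1 → ∀ γ₂ : ℝ, γ₁ < γ₂ → β₀ γ₂ = 1)) := by
  refine ⟨criticalDrive, fun γ hγ => ⟨?_, fun β h => h.eq_criticalDrive hγ, ⟨?_, ?_⟩, ?_, ?_⟩⟩
  · obtain ⟨y, hy, hLip, x, hx⟩ := exists_critical_graph hγ
    refine ⟨criticalDrive_pos hγ, criticalDrive_le_one hγ, ⟨(criticalDrive_pos hγ).le,
      criticalDrive_le_one hγ, ?_⟩, fun φ z h => h.runs_into_saddle hγ hy hLip hx⟩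
    obtain ⟨φ, hmem, hsol, hbot, htop⟩ := hy.exists_connection hγ hLip hx
    exact ⟨φ, _, ⟨hsol, hbot, Eventually.of_forall fun t => hy.pos_between hγ (hmem t)⟩, htop⟩
  · intro β hβ
    obtain ⟨y, hy, hpos⟩ := (mem_runningDrives_iff hγ).2 hβ
    exact ⟨y, hy.isPeriodicGraph hpos, hpos, hy.exists_cycle (hy.lipschitz hγ hpos) hpos⟩
  · intro β hβ0 hβ
    constructor
    · rintro ⟨z, hz⟩
      have hpos := hz.pos hγ hβ0
      exact lt_asymm hβ ((mem_runningDrives_iff hγ).1 ⟨z, hz.isNonnegGraph hpos, hpos⟩)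
    · rintro ⟨n, φ, z, h⟩
      obtain ⟨y, hy, -, x, hx⟩ := exists_critical_graph hγ
      exact absurd (h.drive_le hγ hβ0 hy hx) (not_le.2 hβ)
  · intro β hβ zT hz
    have hpos := hz.pos hγ hβ
    have hy := hz.isNonnegGraph hpos
    exact ⟨fun w hw => (hw.isNonnegGraph (hw.pos hγ hβ)).eq hγ hy,
      fun n φ z h => h.eq_graph hγ hβ hy,
      hy.isStableLimitCycle hγ (hy.lipschitz hγ hpos) hpos⟩
  · intro h γ' hγ'
    exact le_antisymm (criticalDrive_le_one (hγ.trans hγ'))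
      (h.symm.le.trans (criticalDrive_mono hγ hγ'.le))
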